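/- Let $X_1,\dots,X_n$ be nonzero complex Banach spaces, let $\mathcal M$ be the unital algebra (under the usual matrix operations) of all operator matrices $\{T_{ij}\}_{i,j=1}^n$ whose entries $T_{ij}:X_j\to X_i$ are bounded linear operators, and let $\mathcal M^+\subseteq\mathcal M$ be the unital subalgebra of lower triangular matrices ($T_{ij}=0$ for $i<j$). For $A\in\mathcal M^+$ let the causal spectrum $\sigma^+(A)$ be the spectrum of $A$ in the algebra $\mathcal M^+$. A contour is a finite family of closed piecewise continuously differentiable curves in $\mathbb C$. For an open set $U\subseteq\mathbb C$ and $K\subseteq U$, we say that a contour $\Gamma$ surrounds $K$ in $U$ if it lies in $U\setminus K$, has winding number $1$ around every point of $K$, and has winding number $0$ around every point of $\mathbb C\setminus U$. For $f$ analytic in $U$, the divided differences of $f$ at points of $U$ are defined by $f^{[0]}(\mu_1)=f(\mu_1)$ and $$f^{[k]}(\mu_1,\dots,\mu_{k+1})=\frac{f^{[k-1]}(\mu_2,\dots,\mu_{k+1})-f^{[k-1]}(\mu_1,\dots,\mu_k)}{\mu_{k+1}-\mu_1},$$ where, if $\mu_{k+1}=\mu_1$, the quotient is understood as the derivative of $z\mapsto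 f^{[k-1]}(\mu_2,\dots,\mu_k,z)$ at $z=\mu_{k+1}$. Theorem. Let $A\in\mathcal M^+$, let $U\subseteq\mathbb C$ be open with $\sigma^+(A)\subseteq U$ (not necessarily connected), and let $f:U\to\mathbb C$ be analytic. Let $m\ge1$ and $n\ge i_1>i_2>\dots>i_m\ge1$. Let $\Gamma$ be a contour that surrounds $\sigma^+(A)$ in $U$ and put $$f^{[m-1]}(A;i_1,\dots,i_m)=\frac1{2\pi i}\int_\Gamma f(\lambda)(\lambda\mathbf 1-A_{i_1i_1})^{-1}A_{i_1i_2}(\lambda\mathbf 1-A_{i_2i_2})^{-1}A_{i_2i_3}\cdots A_{i_{m-1}i_m}(\lambda\mathbf 1-A_{i_mi_m})^{-1}\,d\lambda .$$ For $k=1,\dots,m$ let $\Gamma_{i_k}$ be a contour that surrounds the spectrum $\sigma(A_{i_ki_k})$ in $U$. Then $$f^{[m-1]}(A;i_1,\dots,i_m)=\frac1{(2\pi i)^m}\int_{\Gamma_{i_1}}\cdots\int_{\Gamma_{i_m}}f^{[m-1]}(\lambda_{i_1},\dots,\lambda_{i_m})(\lambda_{i_1}\mathbf 1-A_{i_1i_1})^{-1}A_{i_1i_2}(\lambda_{i_2}\mathbf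 1-A_{i_2i_2})^{-1}A_{i_2i_3}\cdots A_{i_{m-1}i_m}(\lambda_{i_m}\mathbf 1-A_{i_mi_m})^{-1}\,d\lambda_{i_1}\cdots d\lambda_{i_m},$$ the integrand on the right being a continuous function of $(\lambda_{i_1},\dots,\lambda_{i_m})\in\Gamma_{i_1}\times\dots\times\Gamma_{i_m}$. -/

import Mathlib

namespace CausalCalculus

open scoped ContDiff

/-! ### Block operator matrices and the subalgebra of lower triangular ones -/

section BlockMatrices

variable {n : ℕ} (E : Fin n → Type*) [∀ i, NormedAddCommGroup (E i)]
  [∀ i, NormedSpace ℂ (E i)]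

/-- Operator matrices `T`, the entry `T i j` being a bounded linear operator from the `j`-th space
to the `i`-th space. -/
def BlockMatrix : Type _ := ∀ i j : Fin n, E j →L[ℂ] E i

namespace BlockMatrix

noncomputable instance : AddCommGroup (BlockMatrix E) :=
  inferInstanceAs (AddCommGroup (∀ i j : Fin n, E j →L[ℂ] E i))

noncomputable instance : Module ℂ (BlockMatrix E) :=
  inferInstanceAs (Module ℂ (∀ i j : Fin n, E j →L[ℂ] E i))

/-- The usual matrix product. -/
noncomputable instance : Mul (BlockMatrix E) :=
  ⟨fun S T i j => ∑ k, (S i k).comp (T k j)⟩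

/-- The unit matrix: the entry at `(i, j)` sends `x : E j` to the `i`-th coordinate of the vector
whose only nonzero coordinate is `x`, at place `j`. -/
noncomputable instance : One (BlockMatrix E) :=
  ⟨fun i j => (ContinuousLinearMap.proj i).comp (ContinuousLinearMap.single ℂ E j)⟩

variable {E}

@[ext] theorem ext {S T : BlockMatrix E} (h : ∀ i j x, S i j x = T i j x) : S = T :=
  funext fun i => funext fun j => ContinuousLinearMap.ext (h i j)

theorem zero_entry (i j : Fin n) : (0 : BlockMatrix E) i j = 0 := rfl

theorem add_entry (S T : BlockMatrix E) (i j : Fin n) : (S + T) i j = S i j + T i j := rfl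

theorem smul_entry (c : ℂ) (T : BlockMatrix E) (i j : Fin n) : (c • T) i j = c • T i j := rfl

theorem mul_entry (S T : BlockMatrix E) (i j : Fin n) :
    (S * T) i j = ∑ k, (S i k).comp (T k j) := rfl

theorem one_entry_apply (i j : Fin n) (x : E j) :
    (1 : BlockMatrix E) i j x = Pi.single (M := E) j x i := rfl

theorem one_entry_self (i : Fin n) :
    (1 : BlockMatrix E) i i = ContinuousLinearMap.id ℂ (E i) := by
  ext x; simp [one_entry_apply]

theorem one_entry_of_ne {i j : Fin n} (h : i ≠ j) : (1 : BlockMatrix E) i j = 0 := by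
  ext x; simp [one_entry_apply, h]

theorem mul_entry_apply (S T : BlockMatrix E) (i j : Fin n) (x : E j) :
    (S * T) i j x = ∑ k, S i k (T k j x) := by
  simp [mul_entry]

protected theorem one_mul (T : BlockMatrix E) : 1 * T = T := by
  ext i j x
  rw [mul_entry_apply, Finset.sum_eq_single i]
  · simp [one_entry_self]
  · intro k _ hk; simp [one_entry_of_ne hk.symm]
  · simp

protected theorem mul_one (T : BlockMatrix E) : T * 1 = T := by
  ext i j x
  rw [mul_entry_apply, Finset.sum_eq_single j]
  · simp [one_entry_self]
  · intro k _ hk; simp [one_entry_of_ne hk]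
  · simp

protected theorem mul_assoc (R S T : BlockMatrix E) : R * S * T = R * (S * T) := by
  ext i j x
  simp only [mul_entry_apply, map_sum]
  exact Finset.sum_comm

noncomputable instance : Ring (BlockMatrix E) :=
  { (inferInstance : AddCommGroup (BlockMatrix E)) with
    mul := (· * ·)
    one := 1
    mul_assoc := BlockMatrix.mul_assoc
    one_mul := BlockMatrix.one_mul
    mul_one := BlockMatrix.mul_one
    zero_mul := fun T => by ext i j x; simp [mul_entry_apply, zero_entry]
    mul_zero := fun T => by ext i j x; simp [mul_entry_apply, zero_entry]
    left_distrib := fun R S T => by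
      ext i j x; simp [mul_entry_apply, add_entry, Finset.sum_add_distrib]
    right_distrib := fun R S T => by
      ext i j x; simp [mul_entry_apply, add_entry, Finset.sum_add_distrib] }

/-- The unital complex algebra of all operator matrices. -/
noncomputable instance : Algebra ℂ (BlockMatrix E) :=
  Algebra.ofModule
    (fun c S T => by ext i j x; simp [mul_entry_apply, smul_entry, Finset.smul_sum])
    (fun c S T => by ext i j x; simp [mul_entry_apply, smul_entry, Finset.smul_sum])

end BlockMatrix

/-- The unital subalgebra of all lower triangular operator matrices (causal matrices). -/
noncomputable def lowerTriangular : Subalgebra ℂ (BlockMatrix E) where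
  carrier := {T | ∀ i j : Fin n, i < j → T i j = 0}
  mul_mem' := by
    intro S T hS hT i j hij
    rw [BlockMatrix.mul_entry]
    refine Finset.sum_eq_zero fun k _ => ?_
    rcases lt_or_ge i k with h | h
    · rw [hS i k h, ContinuousLinearMap.zero_comp]
    · rw [hT k j (h.trans_lt hij), ContinuousLinearMap.comp_zero]
  add_mem' := by
    intro S T hS hT i j hij
    rw [BlockMatrix.add_entry, hS i j hij, hT i j hij, add_zero]
  algebraMap_mem' := by
    intro c i j hij
    rw [Algebra.algebraMap_eq_smul_one, BlockMatrix.smul_entry,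
      BlockMatrix.one_entry_of_ne hij.ne, smul_zero]

variable {E}

/-- The causal spectrum: the spectrum in the algebra of lower triangular operator matrices. -/
def causalSpectrum (A : lowerTriangular E) : Set ℂ := spectrum ℂ A

/-- For `i = (i₀, …, iₘ)` and `μ = (μ₀, …, μₘ)`, the alternating product
`(μ₀ - A_{i₀ i₀})⁻¹ A_{i₀ i₁} (μ₁ - A_{i₁ i₁})⁻¹ A_{i₁ i₂} ⋯ A_{iₘ₋₁ iₘ} (μₘ - A_{iₘ iₘ})⁻¹`. -/
noncomputable def resolventProduct (A : BlockMatrix E) : (m : ℕ) → (i : Fin (m + 1) → Fin n) →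
    (μ : Fin (m + 1) → ℂ) → (E (i (Fin.last m)) →L[ℂ] E (i 0))
  | 0, i, μ => (resolvent (A (i 0) (i 0)) (μ 0) : E (i 0) →L[ℂ] E (i 0))
  | m + 1, i, μ =>
      ((resolvent (A (i 0) (i 0)) (μ 0) : E (i 0) →L[ℂ] E (i 0)).comp (A (i 0) (i 1))).comp
        (resolventProduct A m (Fin.tail i) (Fin.tail μ))

end BlockMatrices

/-! ### Contours -/

/-- A closed piecewise continuously differentiable curve in the plane, parametrized by `[0, 1]`
(the values of `toFun` outside `[0, 1]` play no role). -/
structure ClosedCurve where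
  /-- the parametrization -/
  toFun : ℝ → ℂ
  closed : toFun 0 = toFun 1
  continuousOn : ContinuousOn toFun (Set.Icc 0 1)
  piecewise : ∃ (N : ℕ) (t : ℕ → ℝ), Monotone t ∧ t 0 = 0 ∧ t N = 1 ∧
    ∀ k < N, ContDiffOn ℝ 1 toFun (Set.Icc (t k) (t (k + 1)))

/-- A contour consists of finitely many closed curves. -/
abbrev Contour : Type := List ClosedCurve

section Contours

variable {F : Type*} [NormedAddCommGroup F] [NormedSpace ℂ F]

/-- `∫_γ g(z) dz` for one closed curve. -/
noncomputable def ClosedCurve.integral (γ : ClosedCurve) (g : ℂ → F) : F :=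
  ∫ t in (0 : ℝ)..1, deriv γ.toFun t • g (γ.toFun t)

/-- `∫_Γ g(z) dz`. -/
noncomputable def Contour.integral (Γ : Contour) (g : ℂ → F) : F :=
  (Γ.map fun γ => γ.integral g).sum

/-- The set of points on the contour. -/
def Contour.trace (Γ : Contour) : Set ℂ := {z | ∃ γ ∈ Γ, ∃ t ∈ Set.Icc (0 : ℝ) 1, γ.toFun t = z}

/-- The number of times that the contour winds counterclockwise around `w`. -/
noncomputable def Contour.windingNumber (Γ : Contour) (w : ℂ) : ℂ :=
  (2 * Real.pi * Complex.I)⁻¹ * Contour.integral Γ fun z => (z - w)⁻¹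

/-- The contour `Γ` lies in `U` outside `K`, winds exactly once counterclockwise around each point
of `K`, and does not wind around any point outside `U`, i.e. the inside of `Γ` is contained
in `U`. -/
def Contour.Surrounds (Γ : Contour) (K U : Set ℂ) : Prop :=
  Contour.trace Γ ⊆ U \ K ∧ (∀ w ∈ K, Contour.windingNumber Γ w = 1) ∧
    ∀ w, w ∉ U → Contour.windingNumber Γ w = 0

/-- The iterated integral `∫_{Γ₀} … ∫_{Γₘ₋₁} g(μ₀, …, μₘ₋₁) dμₘ₋₁ … dμ₀`; the integral over the
last variable is the innermost one. -/
noncomputable def multiIntegral : (m : ℕ) → (Γ : Fin m → Contour) → (g : (Fin m → ℂ) → F) → F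
  | 0, _, g => g Fin.elim0
  | m + 1, Γ, g => Contour.integral (Γ 0) fun z =>
      multiIntegral m (Fin.tail Γ) fun μ => g (Fin.cons z μ)

end Contours

/-! ### Divided differences -/

/-- The divided difference `f^{[m]}(μ₀, …, μₘ)`, by the usual recursion; when the denominator
`μₘ - μ₀` vanishes, the quotient is replaced by the derivative of the previous divided difference
`f^{[m-1]}(μ₁, …, μₘ)` with respect to its last argument. -/
noncomputable def dividedDifference (f : ℂ → ℂ) : (m : ℕ) → (μ : Fin (m + 1) → ℂ) → ℂ
  | 0, μ => f (μ 0)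
  | m + 1, μ =>
      if μ (Fin.last (m + 1)) = μ 0 then
        deriv (fun z => dividedDifference f m (Function.update (Fin.tail μ) (Fin.last m) z))
          (μ (Fin.last (m + 1)))
      else
        (dividedDifference f m (Fin.tail μ) - dividedDifference f m (Fin.init μ)) /
          (μ (Fin.last (m + 1)) - μ 0)

/-- The operator divided difference
`f^{[m]}(A; i₀, …, iₘ) = (2πi)⁻¹ ∫_Γ f(z) (z - A_{i₀ i₀})⁻¹ A_{i₀ i₁} ⋯ (z - A_{iₘ iₘ})⁻¹ dz`,
calculated along the contour `Γ`. -/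
noncomputable def operatorDividedDifference {n : ℕ} {E : Fin n → Type*}
    [∀ i, NormedAddCommGroup (E i)] [∀ i, NormedSpace ℂ (E i)]
    (Γ : Contour) (f : ℂ → ℂ) (A : BlockMatrix E) (m : ℕ) (i : Fin (m + 1) → Fin n) :
    E (i (Fin.last m)) →L[ℂ] E (i 0) :=
  (2 * Real.pi * Complex.I : ℂ)⁻¹ •
    Contour.integral Γ fun z => f z • resolventProduct A m i fun _ => z

end CausalCalculus

open CausalCalculus

/-!
The theorem rests on a reduction of the multiple integral to a single one, one variable at a time.
Write `R₀(z)` for the resolvent of `A_{i₀ i₀}` and `P(w)` for the resolvent product of the remaining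
indices, all arguments being `w`.

* On `U` the divided difference is an iterated slope: `f^{[m+1]}(μ₀, …, μₘ₊₁)` is the divided
  difference `f^{[m]}(μ₁, …, μₘ₊₁)` of the function `dslope f μ₀`
  (`dividedDifference_eq_newtonDifference`). This uses that slopes at two nodes commute
  (`dslope_dslope_comm`). Joint continuity follows from that of slopes of holomorphic families
  (`continuousOn_dslope_family`).
* Applied to `dslope f z`, the induction hypothesis turns the integral over `Γ₁, …, Γₘ₊₁` into
  `∫_Γ dslope f z w • P(w) dw`. By Fubini, the remaining integral over `Γ₀` can be
  carried out first, for fixed `w` on `Γ`. As `w` lies outside the spectrum of `A_{i₀ i₀}`, the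
  resolvent identity gives
  `∫_{Γ₀} dslope f z w • R₀(z) dz = 2πi f(w) R₀(w) - S R₀(w)` with an operator `S` that does not
  depend on `w` (`Contour.integral_dslope_smul_resolvent`). The contribution of `S` disappears
  because `∫_Γ R₀(w) A_{i₀ i₁} P(w) dw = 0`: the integrand decays quadratically at infinity
  (`Contour.integral_eq_zero_of_isBigO`). In this way neither the existence of auxiliary contours
  nor any relation between the contours is needed.
* For one variable, both contours surround the spectrum in `U`, and the integrals agree by the
  homology version of Cauchy's theorem (`Contour.integral_eq_of_windingNumber_eq`), which is proved
  by Dixon's argument: `z ↦ ∫_Γ dslope φ z w dw` extends to an entire function vanishing at infinity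
  (`Contour.integral_dslope_eq_zero`).
-/

namespace CausalCalculus

open Set Filter Topology MeasureTheory

/-! ### Slopes of holomorphic functions and divided differences -/

section Slopes

variable {F : Type*} [NormedAddCommGroup F] [NormedSpace ℂ F]

theorem dslope_comm (h : ℂ → F) (a b : ℂ) : dslope h a b = dslope h b a := by
  rcases eq_or_ne a b with rfl | hab
  · rfl
  · rw [dslope_of_ne _ hab.symm, dslope_of_ne _ hab, slope_comm]

theorem dslope_eq_smul (h : ℂ → F) {a b : ℂ} (hab : b ≠ a) :
    dslope h a b = (b - a)⁻¹ • (h b - h a) := by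
  rw [dslope_of_ne _ hab, slope_def_module]

theorem deriv_dslope_of_ne {h : ℂ → F} {a b : ℂ} (hab : a ≠ b) (ha : DifferentiableAt ℂ h a) :
    deriv (dslope h b) a = (a - b)⁻¹ • (deriv h a - dslope h b a) := by
  have hd : DifferentiableAt ℂ (dslope h b) a := (differentiableAt_dslope_of_ne hab).2 ha
  have hab' : a - b ≠ 0 := sub_ne_zero.2 hab
  have h1 : HasDerivAt (fun x => (x - b) • dslope h b x)
      ((a - b) • deriv (dslope h b) a + (1 : ℂ) • dslope h b a) a :=
    ((hasDerivAt_id a).sub_const b).smul hd.hasDerivAt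
  have h2 : (fun x => (x - b) • dslope h b x) = fun x => h x - h b := by
    funext x; exact sub_smul_dslope h b x
  rw [h2] at h1
  rw [← deriv_sub_const (f := h) (h b), h1.deriv]
  simp [smul_smul, hab']

/-- Divided differences do not depend on the order of the nodes: the case of two nodes and a
variable. -/
theorem dslope_dslope_comm {h : ℂ → F} {a b : ℂ} (ha : DifferentiableAt ℂ h a)
    (hb : DifferentiableAt ℂ h b) : dslope (dslope h a) b = dslope (dslope h b) a := by
  rcases eq_or_ne a b with rfl | hab
  · rfl
  -- The slope at a node that coincides with the variable is a derivative.
  have key : ∀ {a b : ℂ}, a ≠ b → DifferentiableAt ℂ h a →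
      dslope (dslope h a) b a = dslope (dslope h b) a a := by
    intro a b hab ha
    rw [dslope_same, deriv_dslope_of_ne hab ha, dslope_eq_smul _ hab, dslope_same,
      dslope_comm h a b]
  funext c
  rcases eq_or_ne c a with rfl | hca
  · exact key hab ha
  rcases eq_or_ne c b with rfl | hcb
  · exact (key hab.symm hb).symm
  have h1 : c - a ≠ 0 := sub_ne_zero.2 hca
  have h2 : c - b ≠ 0 := sub_ne_zero.2 hcb
  have h3 : a - b ≠ 0 := sub_ne_zero.2 hab
  have h4 : b - a ≠ 0 := sub_ne_zero.2 hab.symm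
  rw [dslope_eq_smul _ hcb, dslope_eq_smul _ hca, dslope_eq_smul _ hca, dslope_eq_smul _ hcb,
    dslope_eq_smul _ hab, dslope_eq_smul _ hab.symm]
  match_scalars <;> field_simp <;> ring

/-- A bound for the slopes of a holomorphic function near the centre of a disc. -/
theorem norm_dslope_le {g : ℂ → F} {a z w : ℂ} {r M : ℝ} (hr : 0 < r)
    (hg : DifferentiableOn ℂ g (Metric.closedBall a r))
    (hM : ∀ x ∈ Metric.closedBall a r, ‖g x‖ ≤ M)
    (hz : z ∈ Metric.ball a (r / 2)) (hw : w ∈ Metric.ball a (r / 2)) :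
    ‖dslope g z w‖ ≤ M / (r / 2) := by
  have hsub : ∀ x ∈ Metric.ball a (r / 2), Metric.closedBall x (r / 2) ⊆ Metric.closedBall a r := by
    intro x hx
    refine Metric.closedBall_subset_closedBall' ?_
    have := Metric.mem_ball.1 hx
    linarith
  have hder : ∀ x ∈ Metric.ball a (r / 2), ‖deriv g x‖ ≤ M / (r / 2) := by
    intro x hx
    refine Complex.norm_deriv_le_of_forall_mem_sphere_norm_le (by positivity) ?_ fun y hy =>
      hM y (hsub x hx (Metric.sphere_subset_closedBall hy))
    refine DifferentiableOn.diffContOnCl ?_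
    exact (hg.mono (hsub x hx)).mono Metric.closure_ball_subset_closedBall
  have hdiff : ∀ x ∈ Metric.ball a (r / 2), DifferentiableAt ℂ g x := fun x hx =>
    hg.differentiableAt (Filter.mem_of_superset (Metric.closedBall_mem_nhds x (by positivity))
      (hsub x hx))
  rcases eq_or_ne w z with rfl | hwz
  · rw [dslope_same]; exact hder _ hw
  rw [dslope_eq_smul _ hwz, norm_smul, norm_inv,
    inv_mul_le_iff₀ (norm_pos_iff.2 (sub_ne_zero.2 hwz)), mul_comm]
  exact (convex_ball a (r / 2)).norm_image_sub_le_of_norm_deriv_le hdiff hder hz hw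

theorem dslope_sub_apply {g h : ℂ → F} {a b : ℂ} (hg : DifferentiableAt ℂ g a)
    (hh : DifferentiableAt ℂ h a) :
    dslope (fun x => g x - h x) a b = dslope g a b - dslope h a b := by
  rcases eq_or_ne b a with rfl | hab
  · simp only [dslope_same]; exact deriv_fun_sub hg hh
  · simp only [dslope_eq_smul _ hab, ← smul_sub]; congr 1; abel

/-- The slopes of a family of holomorphic functions that depends continuously on a parameter are
jointly continuous in the parameter and the two points. -/
theorem continuousOn_dslope_family [CompleteSpace F] {X : Type*} [TopologicalSpace X] {S : Set X}
    {U : Set ℂ} (hU : IsOpen U) {f : X → ℂ → F} (hc : ContinuousOn (Function.uncurry f) (S ×ˢ U))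
    (hf : ∀ p ∈ S, DifferentiableOn ℂ (f p) U) :
    ContinuousOn (fun q : (X × ℂ) × ℂ => dslope (f q.1.1) q.1.2 q.2) ((S ×ˢ U) ×ˢ U) := by
  rintro ⟨⟨p, a⟩, b⟩ ⟨⟨hp, ha⟩, hb⟩
  simp only at hp ha hb
  rcases eq_or_ne b a with rfl | hab
  · -- On the diagonal, the slopes of `f p' - f p` are small by the Cauchy estimate.
    obtain ⟨r, hr, hrU⟩ := Metric.nhds_basis_closedBall.mem_iff.1 (hU.mem_nhds ha)
    have hat : ∀ p' ∈ S, ∀ x ∈ U, DifferentiableAt ℂ (f p') x := fun p' hp' x hx =>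
      (hf p' hp').differentiableAt (hU.mem_nhds hx)
    have hpoint : ContinuousAt (fun q : ℂ × ℂ => dslope (f p) q.1 q.2) (b, b) := by
      -- For a single function, this is strict differentiability.
      have hs : HasStrictDerivAt (f p) (deriv (f p) b) b :=
        ((hf p hp).analyticAt (hU.mem_nhds hb)).hasStrictDerivAt
      have hd : ContinuousAt (deriv (f p)) b :=
        ((hf p hp).deriv hU).continuousOn.continuousAt (hU.mem_nhds hb)
      rw [Metric.continuousAt_iff']
      intro ε hε
      have h1 := hs.hasStrictFDerivAt.isLittleO.def (half_pos hε)
      have h2 : ∀ᶠ q : ℂ × ℂ in 𝓝 (b, b), dist (deriv (f p) q.1) (deriv (f p) b) < ε :=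
        (continuousAt_fst (p := (b, b))).eventually (Metric.continuousAt_iff'.1 hd ε hε)
      filter_upwards [h1, h2] with q h1 h2
      rw [dslope_same]
      rcases eq_or_ne q.2 q.1 with h | h
      · rw [h, dslope_same]; exact h2
      · have hn : 0 < ‖q.1 - q.2‖ := norm_pos_iff.2 (sub_ne_zero.2 h.symm)
        rw [dslope_comm, dslope_eq_smul _ h.symm, dist_eq_norm]
        have e : (q.1 - q.2)⁻¹ • (f p q.1 - f p q.2) - deriv (f p) b =
            (q.1 - q.2)⁻¹ • (f p q.1 - f p q.2 - (q.1 - q.2) • deriv (f p) b) := by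
          rw [smul_sub _ (f p q.1 - f p q.2), smul_smul, inv_mul_cancel₀ (sub_ne_zero.2 h.symm),
            one_smul]
        rw [e, norm_smul, norm_inv, inv_mul_lt_iff₀ hn]
        rw [ContinuousLinearMap.toSpanSingleton_apply] at h1
        refine h1.trans_lt ?_
        rw [mul_comm]
        exact mul_lt_mul_of_pos_left (half_lt_self hε) hn
    rw [ContinuousWithinAt, Metric.tendsto_nhds]
    intro ε hε
    obtain ⟨v, hv, hvs⟩ := (isCompact_closedBall b r).mem_uniformity_of_prod
      (f := f) (hc.mono (prod_mono_right hrU)) hp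
      (Metric.dist_mem_uniformity (show (0 : ℝ) < ε / 3 * (r / 2) by positivity))
    have hv' : ∀ᶠ p' in 𝓝[S] p, p' ∈ v := hv
    have e1 : ∀ᶠ q : (X × ℂ) × ℂ in 𝓝[(S ×ˢ U) ×ˢ U] ((p, b), b), q.1.1 ∈ v := by
      refine Tendsto.eventually (f := fun q : (X × ℂ) × ℂ => q.1.1) ?_ hv'
      refine tendsto_nhdsWithin_of_tendsto_nhds_of_eventually_within _ ?_ ?_
      · exact tendsto_nhdsWithin_of_tendsto_nhds
          ((continuous_fst.comp continuous_fst).tendsto _)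
      · filter_upwards [self_mem_nhdsWithin] with q hq using hq.1.1
    have e2 : ∀ᶠ q : (X × ℂ) × ℂ in 𝓝[(S ×ˢ U) ×ˢ U] ((p, b), b),
        dist (dslope (f p) q.1.2 q.2) (dslope (f p) b b) < ε / 3 := by
      have : Tendsto (fun q : (X × ℂ) × ℂ => (q.1.2, q.2)) (𝓝[(S ×ˢ U) ×ˢ U] ((p, b), b))
          (𝓝 (b, b)) := by
        refine tendsto_nhdsWithin_of_tendsto_nhds ?_
        exact ((continuous_snd.comp continuous_fst).prodMk continuous_snd).tendsto ((p, b), b)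
      exact this.eventually (Metric.continuousAt_iff'.1 hpoint (ε / 3) (by positivity))
    have e3 : ∀ᶠ q : (X × ℂ) × ℂ in 𝓝[(S ×ˢ U) ×ˢ U] ((p, b), b),
        q.1.2 ∈ Metric.ball b (r / 2) := by
      refine Tendsto.eventually (f := fun q : (X × ℂ) × ℂ => q.1.2)
        (tendsto_nhdsWithin_of_tendsto_nhds ((continuous_snd.comp continuous_fst).tendsto _))
        (Metric.ball_mem_nhds b (by positivity))
    have e4 : ∀ᶠ q : (X × ℂ) × ℂ in 𝓝[(S ×ˢ U) ×ˢ U] ((p, b), b),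
        q.2 ∈ Metric.ball b (r / 2) := by
      refine Tendsto.eventually (f := fun q : (X × ℂ) × ℂ => q.2)
        (tendsto_nhdsWithin_of_tendsto_nhds (continuous_snd.tendsto _))
        (Metric.ball_mem_nhds b (by positivity))
    filter_upwards [e1, e2, e3, e4, self_mem_nhdsWithin] with q h1 h2 h3 h4 h5
    have hb := norm_dslope_le (g := fun x => f q.1.1 x - f p x) (M := ε / 3 * (r / 2)) hr
      (((hf _ h5.1.1).sub (hf p hp)).mono hrU) (fun x hx => ?_) h3 h4
    · rw [dslope_sub_apply (hat _ h5.1.1 _ h5.1.2) (hat _ hp _ h5.1.2),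
        mul_div_cancel_right₀ _ (by positivity), ← dist_eq_norm] at hb
      calc _ ≤ _ := dist_triangle _ (dslope (f p) q.1.2 q.2) _
        _ < ε := by linarith
    · have := hvs _ h1 x hx
      rw [mem_ofPred_eq, dist_eq_norm] at this
      exact this.le
  · have hne : ∀ᶠ q : (X × ℂ) × ℂ in 𝓝[(S ×ˢ U) ×ˢ U] ((p, a), b), q.2 ≠ q.1.2 := by
      have ho : IsOpen {q : (X × ℂ) × ℂ | q.2 ≠ q.1.2} :=
        isOpen_ne_fun continuous_snd (continuous_snd.comp continuous_fst)
      exact mem_nhdsWithin_of_mem_nhds (ho.mem_nhds hab)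
    have hcont : ContinuousWithinAt
        (fun q : (X × ℂ) × ℂ => (q.2 - q.1.2)⁻¹ • (f q.1.1 q.2 - f q.1.1 q.1.2))
        ((S ×ˢ U) ×ˢ U) ((p, a), b) := by
      have c1 : ContinuousWithinAt (fun q : (X × ℂ) × ℂ => f q.1.1 q.2)
          ((S ×ˢ U) ×ˢ U) ((p, a), b) :=
        ContinuousOn.comp (g := Function.uncurry f) (f := fun q : (X × ℂ) × ℂ => (q.1.1, q.2)) hc
          (by fun_prop) (fun q hq => ⟨hq.1.1, hq.2⟩) _ ⟨⟨hp, ha⟩, hb⟩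
      have c2 : ContinuousWithinAt (fun q : (X × ℂ) × ℂ => f q.1.1 q.1.2)
          ((S ×ˢ U) ×ˢ U) ((p, a), b) :=
        ContinuousOn.comp (g := Function.uncurry f) (f := fun q : (X × ℂ) × ℂ => q.1) hc
          (by fun_prop) (fun q hq => hq.1) _ ⟨⟨hp, ha⟩, hb⟩
      have c3 : ContinuousWithinAt (fun q : (X × ℂ) × ℂ => q.2 - q.1.2)
          ((S ×ˢ U) ×ˢ U) ((p, a), b) := by fun_prop
      exact (c3.inv₀ (sub_ne_zero.2 hab)).smul (c1.sub c2)
    refine hcont.congr_of_eventuallyEq ?_ (dslope_eq_smul _ hab)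
    filter_upwards [hne] with q hq using dslope_eq_smul _ hq

theorem continuousOn_dslope_prod [CompleteSpace F] {U : Set ℂ} (hU : IsOpen U) {f : ℂ → F}
    (hf : DifferentiableOn ℂ f U) :
    ContinuousOn (fun q : ℂ × ℂ => dslope f q.1 q.2) (U ×ˢ U) := by
  have h := continuousOn_dslope_family (X := Unit) (S := univ) hU (f := fun _ => f)
    (hf.continuousOn.comp continuousOn_snd fun q hq => hq.2) fun _ _ => hf
  exact h.comp (f := fun q : ℂ × ℂ => (((), q.1), q.2)) (by fun_prop)
    fun q hq => ⟨⟨mem_univ _, hq.1⟩, hq.2⟩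

theorem differentiableOn_dslope_left [CompleteSpace F] {U : Set ℂ} (hU : IsOpen U) {f : ℂ → F}
    (hf : DifferentiableOn ℂ f U) {w : ℂ} (hw : w ∈ U) :
    DifferentiableOn ℂ (fun z => dslope f z w) U := by
  simp_rw [fun z => dslope_comm f z w]
  exact (Complex.differentiableOn_dslope (hU.mem_nhds hw)).2 hf

end Slopes

section DividedDifferences

/-- The divided difference with fixed nodes `ν₀, …, νₘ₋₁` as a function of one further node,
obtained by passing to the slope `z ↦ dslope f ν z` at one node after another. -/
noncomputable def iteratedDslope : (ℂ → ℂ) → (m : ℕ) → (Fin m → ℂ) → ℂ → ℂ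
  | f, 0, _ => f
  | f, m + 1, ν => iteratedDslope (dslope f (ν 0)) m (Fin.tail ν)

/-- The divided difference `f^{[m]}(μ₀, …, μₘ)` as an iterated slope. Unlike the recursion of
`dividedDifference`, this one changes the function and removes a single node. -/
noncomputable def newtonDifference (f : ℂ → ℂ) (m : ℕ) (μ : Fin (m + 1) → ℂ) : ℂ :=
  iteratedDslope f m (Fin.init μ) (μ (Fin.last m))

theorem newtonDifference_succ (f : ℂ → ℂ) (m : ℕ) (μ : Fin (m + 2) → ℂ) :
    newtonDifference f (m + 1) μ = newtonDifference (dslope f (μ 0)) m (Fin.tail μ) := by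
  rw [newtonDifference, iteratedDslope, Fin.tail_init_eq_init_tail]
  rfl

theorem iteratedDslope_succ_last (f : ℂ → ℂ) (m : ℕ) (ν : Fin (m + 1) → ℂ) :
    iteratedDslope f (m + 1) ν = dslope (iteratedDslope f m (Fin.init ν)) (ν (Fin.last m)) := by
  induction m generalizing f with
  | zero => rfl
  | succ m ih =>
    rw [iteratedDslope, ih, iteratedDslope, Fin.tail_init_eq_init_tail]
    rfl

variable {U : Set ℂ}

/-- The nodes of an iterated slope may be permuted: the first node can be moved to the end. -/
theorem iteratedDslope_dslope (hU : IsOpen U) {f : ℂ → ℂ} (hf : DifferentiableOn ℂ f U) {a : ℂ}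
    (ha : a ∈ U) (m : ℕ) {ν : Fin m → ℂ} (hν : ∀ k, ν k ∈ U) :
    iteratedDslope (dslope f a) m ν = dslope (iteratedDslope f m ν) a := by
  induction m generalizing f with
  | zero => rfl
  | succ m ih =>
    rw [iteratedDslope, dslope_dslope_comm (hf.differentiableAt (hU.mem_nhds ha))
      (hf.differentiableAt (hU.mem_nhds (hν 0))),
      ih ((Complex.differentiableOn_dslope (hU.mem_nhds (hν 0))).2 hf) (ν := Fin.tail ν)
        fun k => hν k.succ]
    rfl

theorem dividedDifference_eq_newtonDifference (hU : IsOpen U) {f : ℂ → ℂ}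
    (hf : DifferentiableOn ℂ f U) (m : ℕ) {μ : Fin (m + 1) → ℂ} (hμ : ∀ k, μ k ∈ U) :
    dividedDifference f m μ = newtonDifference f m μ := by
  induction m with
  | zero => rfl
  | succ m ih =>
    have hN : newtonDifference f (m + 1) μ =
        dslope (iteratedDslope f m (Fin.init (Fin.tail μ))) (μ 0) (μ (Fin.last (m + 1))) := by
      rw [newtonDifference_succ, newtonDifference,
        iteratedDslope_dslope hU hf (hμ 0) m (ν := Fin.init (Fin.tail μ)) fun k => hμ _]
      rfl
    rw [hN, dividedDifference]
    split_ifs with h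
    · rw [h, dslope_same]
      refine Filter.EventuallyEq.deriv_eq ?_
      filter_upwards [hU.mem_nhds (hμ 0)] with z hz
      rw [ih, newtonDifference, Fin.init_update_last, Function.update_self]
      intro k
      rcases eq_or_ne k (Fin.last m) with rfl | hk
      · rwa [Function.update_self]
      · rw [Function.update_of_ne hk]; exact hμ _
    · -- The node `μ₀` is moved to the end and then interchanged with the variable.
      have hinit : newtonDifference f m (Fin.init μ) =
          iteratedDslope f m (Fin.init (Fin.tail μ)) (μ 0) := by
        rcases m with _ | k
        · rfl
        · rw [newtonDifference_succ, newtonDifference, iteratedDslope_succ_last,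
            Fin.tail_init_eq_init_tail, iteratedDslope_dslope hU hf (a := Fin.init μ 0) (hμ 0) k
              (ν := Fin.init (Fin.init (Fin.tail μ))) fun j => hμ _, dslope_comm]
          rfl
      rw [dslope_eq_smul _ h, ih (μ := Fin.tail μ) fun k => hμ _, ih (μ := Fin.init μ) fun k => hμ _,
        hinit, smul_eq_mul, div_eq_inv_mul]
      rfl

theorem continuousOn_newtonDifference_family (hU : IsOpen U) (m : ℕ) {X : Type*}
    [TopologicalSpace X] {S : Set X} {f : X → ℂ → ℂ}
    (hc : ContinuousOn (Function.uncurry f) (S ×ˢ U)) (hf : ∀ p ∈ S, DifferentiableOn ℂ (f p) U) :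
    ContinuousOn (fun q : X × (Fin (m + 1) → ℂ) => newtonDifference (f q.1) m q.2)
      (S ×ˢ univ.pi fun _ => U) := by
  induction m generalizing X with
  | zero =>
    exact hc.comp (f := fun q : X × (Fin 1 → ℂ) => (q.1, q.2 0)) (by fun_prop)
      fun q hq => ⟨hq.1, hq.2 0 (mem_univ _)⟩
  | succ m ih =>
    have h := ih (X := X × ℂ) (S := S ×ˢ U) (f := fun q => dslope (f q.1) q.2)
      (continuousOn_dslope_family hU hc hf) fun q hq =>
        (Complex.differentiableOn_dslope (hU.mem_nhds hq.2)).2 (hf _ hq.1)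
    simp_rw [newtonDifference_succ]
    exact h.comp (f := fun q : X × (Fin (m + 2) → ℂ) => ((q.1, q.2 0), Fin.tail q.2))
      (by unfold Fin.tail; fun_prop)
      fun q hq => ⟨⟨hq.1, hq.2 0 (mem_univ _)⟩, fun k _ => hq.2 k.succ (mem_univ _)⟩

theorem continuousOn_newtonDifference (hU : IsOpen U) {f : ℂ → ℂ} (hf : DifferentiableOn ℂ f U)
    (m : ℕ) : ContinuousOn (newtonDifference f m) (univ.pi fun _ => U) := by
  have h := continuousOn_newtonDifference_family hU m (X := Unit) (S := univ) (f := fun _ => f)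
    (hf.continuousOn.comp continuousOn_snd fun q hq => hq.2) fun _ _ => hf
  exact h.comp (f := fun μ : Fin (m + 1) → ℂ => ((), μ)) (by fun_prop)
    fun μ hμ => ⟨mem_univ _, hμ⟩

end DividedDifferences

/-! ### Integrals along contours -/

section CurveIntegrals

variable {F : Type*} [NormedAddCommGroup F] [NormedSpace ℂ F]

namespace ClosedCurve

/-- A closed curve is differentiable except at its breakpoints. -/
theorem exists_countable_hasDerivAt (γ : ClosedCurve) :
    ∃ s : Set ℝ, s.Countable ∧
      ∀ x ∈ Ioo (0 : ℝ) 1 \ s, HasDerivAt γ.toFun (deriv γ.toFun x) x := by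
  obtain ⟨N, t, -, ht0, htN, hd⟩ := γ.piecewise
  refine ⟨range t, countable_range t, fun x hx => ?_⟩
  have hxt : ∀ j, t j ≠ x := fun j h => hx.2 ⟨j, h⟩
  have key : ∀ j, x < t j → ∃ k < j, t k < x ∧ x < t (k + 1) := by
    intro j
    induction j with
    | zero => intro h; rw [ht0] at h; exact absurd h hx.1.1.not_gt
    | succ j ih =>
      intro h
      rcases lt_or_gt_of_ne (hxt j) with h' | h'
      · exact ⟨j, j.lt_succ_self, h', h⟩
      · obtain ⟨k, hk, hk'⟩ := ih h'
        exact ⟨k, hk.trans j.lt_succ_self, hk'⟩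
  obtain ⟨k, hk, h1, h2⟩ := key N (htN ▸ hx.1.2)
  exact (((hd k hk).differentiableOn one_ne_zero).differentiableAt
    (Icc_mem_nhds h1 h2)).hasDerivAt

theorem intervalIntegrable_deriv (γ : ClosedCurve) :
    IntervalIntegrable (deriv γ.toFun) volume 0 1 := by
  obtain ⟨N, t, hmono, ht0, htN, hd⟩ := γ.piecewise
  rw [← ht0, ← htN]
  refine IntervalIntegrable.trans_iterate fun k hk => ?_
  rcases (hmono k.le_succ).eq_or_lt with h | h
  · simp only [Nat.succ_eq_add_one] at h
    rw [h]
  have hc := (hd k hk).continuousOn_derivWithin (uniqueDiffOn_Icc h) le_rfl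
  have hi := hc.intervalIntegrable_of_Icc (μ := volume) h.le
  rw [intervalIntegrable_iff_integrableOn_Ioo_of_le h.le] at hi ⊢
  exact hi.congr_fun (fun x hx => derivWithin_of_mem_nhds (Icc_mem_nhds hx.1 hx.2))
    measurableSet_Ioo

theorem continuousOn_comp {X : Type*} [TopologicalSpace X] (γ : ClosedCurve) {g : ℂ → X}
    (hg : ContinuousOn g (γ.toFun '' Icc 0 1)) :
    ContinuousOn (fun t => g (γ.toFun t)) (uIcc 0 1) := by
  rw [uIcc_of_le zero_le_one]
  exact hg.comp γ.continuousOn fun t ht => mem_image_of_mem _ ht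

theorem intervalIntegrable (γ : ClosedCurve) {g : ℂ → F}
    (hg : ContinuousOn g (γ.toFun '' Icc 0 1)) :
    IntervalIntegrable (fun t => deriv γ.toFun t • g (γ.toFun t)) volume 0 1 :=
  γ.intervalIntegrable_deriv.smul_continuousOn (γ.continuousOn_comp hg)

theorem integral_congr (γ : ClosedCurve) {g h : ℂ → F}
    (hgh : ∀ z ∈ γ.toFun '' Icc 0 1, g z = h z) : γ.integral g = γ.integral h := by
  refine intervalIntegral.integral_congr fun t ht => ?_
  rw [uIcc_of_le zero_le_one] at ht
  simp only [hgh _ (mem_image_of_mem _ ht)]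

theorem integral_add (γ : ClosedCurve) {g h : ℂ → F} (hg : ContinuousOn g (γ.toFun '' Icc 0 1))
    (hh : ContinuousOn h (γ.toFun '' Icc 0 1)) :
    γ.integral (fun z => g z + h z) = γ.integral g + γ.integral h := by
  simp only [integral, smul_add]
  exact intervalIntegral.integral_add (γ.intervalIntegrable hg) (γ.intervalIntegrable hh)

theorem integral_smul (γ : ClosedCurve) (c : ℂ) (g : ℂ → F) :
    γ.integral (fun z => c • g z) = c • γ.integral g := by
  simp only [integral, smul_comm _ c]
  exact intervalIntegral.integral_smul _ _

theorem integral_clm {G : Type*} [NormedAddCommGroup G] [NormedSpace ℂ G] [CompleteSpace F]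
    [CompleteSpace G] (γ : ClosedCurve) (L : F →L[ℂ] G) {g : ℂ → F}
    (hg : ContinuousOn g (γ.toFun '' Icc 0 1)) :
    γ.integral (fun z => L (g z)) = L (γ.integral g) := by
  simp only [integral, ← map_smul]
  exact L.intervalIntegral_comp_comm (γ.intervalIntegrable hg)

/-- The integral of a derivative along a closed curve vanishes. -/
theorem integral_eq_zero_of_hasDerivAt [CompleteSpace F] (γ : ClosedCurve) {G g : ℂ → F}
    (hg : ContinuousOn g (γ.toFun '' Icc 0 1))
    (hG : ∀ w ∈ γ.toFun '' Icc 0 1, HasDerivAt G (g w) w) : γ.integral g = 0 := by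
  obtain ⟨s, hs, hd⟩ := γ.exists_countable_hasDerivAt
  have h := integral_eq_of_hasDerivAt_off_countable_of_le (fun t => G (γ.toFun t))
    (fun t => deriv γ.toFun t • g (γ.toFun t)) zero_le_one hs ?_ ?_ (γ.intervalIntegrable hg)
  · rw [integral, h, γ.closed, sub_self]
  · intro t ht
    exact (hG _ (mem_image_of_mem _ ht)).continuousAt.comp_continuousWithinAt (γ.continuousOn t ht)
  · intro t ht
    exact (hG _ (mem_image_of_mem _ (Ioo_subset_Icc_self ht.1))).scomp t (hd t ht)

theorem exists_norm_integral_le (γ : ClosedCurve) :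
    ∃ C : ℝ, 0 ≤ C ∧ ∀ (g : ℂ → F) (M : ℝ), (∀ w ∈ γ.toFun '' Icc 0 1, ‖g w‖ ≤ M) →
      ‖γ.integral g‖ ≤ C * M := by
  refine ⟨∫ t in (0 : ℝ)..1, ‖deriv γ.toFun t‖, intervalIntegral.integral_nonneg zero_le_one
    fun _ _ => norm_nonneg _, fun g M hM => ?_⟩
  rw [← intervalIntegral.integral_mul_const]
  refine intervalIntegral.norm_integral_le_of_norm_le zero_le_one (ae_of_all _ fun t ht => ?_)
    (γ.intervalIntegrable_deriv.norm.mul_const M)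
  rw [norm_smul]
  exact mul_le_mul_of_nonneg_left (hM _ (mem_image_of_mem _ (Ioc_subset_Icc_self ht)))
    (norm_nonneg _)

theorem continuousOn_integral (γ : ClosedCurve) {S : Set ℂ} (hS : IsCompact S) {g : ℂ → ℂ → F}
    (hg : ContinuousOn (Function.uncurry g) (S ×ˢ (γ.toFun '' Icc 0 1))) :
    ContinuousOn (fun z => γ.integral (g z)) S := by
  obtain ⟨M, hM⟩ := (hS.prod
    (isCompact_Icc.image_of_continuousOn γ.continuousOn)).exists_bound_of_continuousOn hg
  have hgz : ∀ z ∈ S, ContinuousOn (g z) (γ.toFun '' Icc 0 1) := fun z hz =>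
    hg.comp (f := fun w => (z, w)) (by fun_prop) fun w hw => ⟨hz, hw⟩
  intro z hz
  refine intervalIntegral.continuousWithinAt_of_dominated_interval
    (bound := fun t => ‖deriv γ.toFun t‖ * M) ?_ ?_ (γ.intervalIntegrable_deriv.norm.mul_const M) ?_
  · filter_upwards [self_mem_nhdsWithin] with y hy
    exact (γ.intervalIntegrable (hgz y hy)).def'.aestronglyMeasurable
  · filter_upwards [self_mem_nhdsWithin] with y hy
    refine ae_of_all _ fun t ht => ?_
    rw [uIoc_of_le zero_le_one] at ht
    rw [norm_smul]
    exact mul_le_mul_of_nonneg_left (hM (y, _) ⟨hy, mem_image_of_mem _ (Ioc_subset_Icc_self ht)⟩)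
      (norm_nonneg _)
  · refine ae_of_all _ fun t ht => ?_
    rw [uIoc_of_le zero_le_one] at ht
    refine ContinuousWithinAt.const_smul ?_ _
    exact (hg.comp (f := fun y => (y, γ.toFun t)) (by fun_prop)
      fun y hy => ⟨hy, mem_image_of_mem _ (Ioc_subset_Icc_self ht)⟩) z hz

/-- A curve integral depends holomorphically on a parameter if the integrand does. -/
theorem differentiableOn_integral (γ : ClosedCurve) {V : Set ℂ} (hV : IsOpen V) {g : ℂ → ℂ → F}
    (hg : ContinuousOn (Function.uncurry g) (V ×ˢ (γ.toFun '' Icc 0 1)))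
    (hd : ∀ w ∈ γ.toFun '' Icc 0 1, DifferentiableOn ℂ (fun z => g z w) V) :
    DifferentiableOn ℂ (fun z => γ.integral (g z)) V := by
  intro z₀ hz₀
  refine DifferentiableAt.differentiableWithinAt ?_
  obtain ⟨r, hr, hrV⟩ := Metric.nhds_basis_closedBall.mem_iff.1 (hV.mem_nhds hz₀)
  obtain ⟨M, hM⟩ := ((isCompact_closedBall z₀ r).prod
    (isCompact_Icc.image_of_continuousOn γ.continuousOn)).exists_bound_of_continuousOn
      (hg.mono (prod_mono_left hrV))
  have hgz : ∀ z ∈ V, ContinuousOn (g z) (γ.toFun '' Icc 0 1) := fun z hz =>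
    hg.comp (f := fun w => (z, w)) (by fun_prop) fun w hw => ⟨hz, hw⟩
  have hat : ∀ w ∈ γ.toFun '' Icc 0 1, ∀ z ∈ V, HasDerivAt (fun z => g z w)
      (deriv (fun z => g z w) z) z := fun w hw z hz =>
    ((hd w hw).differentiableAt (hV.mem_nhds hz)).hasDerivAt
  have hball : ∀ z ∈ Metric.ball z₀ (r / 2),
      Metric.closedBall z (r / 2) ⊆ Metric.closedBall z₀ r := by
    intro x hx
    refine Metric.closedBall_subset_closedBall' ?_
    have := Metric.mem_ball.1 hx
    linarith
  have hball' : ∀ z ∈ Metric.ball z₀ (r / 2), z ∈ V := fun z hz =>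
    hrV (hball z hz (Metric.mem_closedBall_self (by positivity)))
  -- The Cauchy estimate on discs of radius `r / 2` dominates the derivatives.
  refine (intervalIntegral.hasDerivAt_integral_of_dominated_loc_of_deriv_le
    (F' := fun z t => deriv γ.toFun t • deriv (fun z => g z (γ.toFun t)) z)
    (bound := fun t => ‖deriv γ.toFun t‖ * (M / (r / 2)))
    (Metric.ball_mem_nhds z₀ (half_pos hr)) ?_ (γ.intervalIntegrable (hgz z₀ hz₀)) ?_ ?_
    (γ.intervalIntegrable_deriv.norm.mul_const _) ?_).2.differentiableAt
  · filter_upwards [hV.mem_nhds hz₀] with y hy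
    exact (γ.intervalIntegrable (hgz y hy)).def'.aestronglyMeasurable
  · -- The derivative is a pointwise limit of difference quotients, which are continuous in `t`.
    refine γ.intervalIntegrable_deriv.def'.aestronglyMeasurable.smul ?_
    have hseq : Tendsto (fun n : ℕ => z₀ + ((r / ((n : ℝ) + 1) : ℝ) : ℂ)) atTop (𝓝[≠] z₀) := by
      refine tendsto_nhdsWithin_of_tendsto_nhds_of_eventually_within _ ?_ ?_
      · have h0 : Tendsto (fun n : ℕ => r / ((n : ℝ) + 1)) atTop (𝓝 0) := by
          simpa using tendsto_one_div_add_atTop_nhds_zero_nat.const_mul r |>.congr fun n => by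
            rw [mul_one_div]
        have h1 := (Complex.continuous_ofReal.tendsto 0).comp h0
        simpa using h1.const_add z₀
      · filter_upwards with n
        have : r / ((n : ℝ) + 1) ≠ 0 := by positivity
        simpa [hr.ne'] using (by exact_mod_cast this : ((r / ((n : ℝ) + 1) : ℝ) : ℂ) ≠ 0)
    refine aestronglyMeasurable_of_tendsto_ae atTop
      (f := fun (n : ℕ) t => slope (fun z => g z (γ.toFun t)) z₀
        (z₀ + ((r / ((n : ℝ) + 1) : ℝ) : ℂ)))
      (fun n => ?_) ?_
    · refine ContinuousOn.aestronglyMeasurable ?_ measurableSet_uIoc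
      have hmem : z₀ + ((r / ((n : ℝ) + 1) : ℝ) : ℂ) ∈ V := by
        refine hrV ?_
        rw [Metric.mem_closedBall, dist_eq_norm, add_sub_cancel_left, Complex.norm_real,
          Real.norm_of_nonneg (by positivity)]
        exact div_le_self hr.le (by linarith [(Nat.cast_nonneg n : (0 : ℝ) ≤ n)])
      simp only [slope_def_module]
      exact (((γ.continuousOn_comp (hgz _ hmem)).sub
        (γ.continuousOn_comp (hgz _ hz₀))).const_smul _).mono uIoc_subset_uIcc
    · refine (ae_restrict_iff' measurableSet_uIoc).2 (ae_of_all _ fun t ht => ?_)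
      rw [uIoc_of_le zero_le_one] at ht
      exact (hasDerivAt_iff_tendsto_slope.1
        (hat _ (mem_image_of_mem _ (Ioc_subset_Icc_self ht)) z₀ hz₀)).comp hseq
  · refine ae_of_all _ fun t ht z hz => ?_
    rw [uIoc_of_le zero_le_one] at ht
    have htm : γ.toFun t ∈ γ.toFun '' Icc 0 1 := mem_image_of_mem _ (Ioc_subset_Icc_self ht)
    rw [norm_smul]
    refine mul_le_mul_of_nonneg_left ?_ (norm_nonneg _)
    refine Complex.norm_deriv_le_of_forall_mem_sphere_norm_le (by positivity) ?_ fun y hy =>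
      hM (y, γ.toFun t) ⟨hball z hz (Metric.sphere_subset_closedBall hy), htm⟩
    refine DifferentiableOn.diffContOnCl ?_
    exact ((hd _ htm).mono ((hball z hz).trans hrV)).mono Metric.closure_ball_subset_closedBall
  · refine ae_of_all _ fun t ht z hz => ?_
    rw [uIoc_of_le zero_le_one] at ht
    exact (hat _ (mem_image_of_mem _ (Ioc_subset_Icc_self ht)) z (hball' z hz)).const_smul _

/-- Fubini's theorem for two curves. -/
theorem integral_integral_swap (γ γ' : ClosedCurve) {k : ℂ → ℂ → F}
    (hk : ContinuousOn (Function.uncurry k) ((γ.toFun '' Icc 0 1) ×ˢ (γ'.toFun '' Icc 0 1))) :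
    γ.integral (fun z => γ'.integral (k z)) = γ'.integral fun w => γ.integral fun z => k z w := by
  obtain ⟨M, hM⟩ := ((isCompact_Icc.image_of_continuousOn γ.continuousOn).prod
    (isCompact_Icc.image_of_continuousOn γ'.continuousOn)).exists_bound_of_continuousOn hk
  simp only [integral, ← intervalIntegral.integral_smul]
  simp only [intervalIntegral.integral_of_le zero_le_one]
  rw [MeasureTheory.integral_integral_swap]
  · exact integral_congr_ae (ae_of_all _ fun w => integral_congr_ae
      (ae_of_all _ fun z => smul_comm _ _ _))
  have h1 : IntegrableOn (deriv γ.toFun) (Ioc 0 1) :=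
    (intervalIntegrable_iff_integrableOn_Ioc_of_le zero_le_one).1 γ.intervalIntegrable_deriv
  have h2 : IntegrableOn (deriv γ'.toFun) (Ioc 0 1) :=
    (intervalIntegrable_iff_integrableOn_Ioc_of_le zero_le_one).1 γ'.intervalIntegrable_deriv
  have h3 := h1.mul_prod h2
  have hsub : ∀ p ∈ Ioc (0 : ℝ) 1 ×ˢ Ioc (0 : ℝ) 1, (γ.toFun p.1, γ'.toFun p.2) ∈
      (γ.toFun '' Icc 0 1) ×ˢ (γ'.toFun '' Icc 0 1) := fun p hp =>
    ⟨mem_image_of_mem _ (Ioc_subset_Icc_self hp.1), mem_image_of_mem _ (Ioc_subset_Icc_self hp.2)⟩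
  have hcont : ContinuousOn (fun p : ℝ × ℝ => k (γ.toFun p.1) (γ'.toFun p.2))
      (Ioc 0 1 ×ˢ Ioc 0 1) := by
    refine hk.comp (f := fun p : ℝ × ℝ => (γ.toFun p.1, γ'.toFun p.2)) ?_ hsub
    exact (γ.continuousOn.comp continuousOn_fst fun p hp => Ioc_subset_Icc_self hp.1).prodMk
      (γ'.continuousOn.comp continuousOn_snd fun p hp => Ioc_subset_Icc_self hp.2)
  have h4 : AEStronglyMeasurable (fun p : ℝ × ℝ => k (γ.toFun p.1) (γ'.toFun p.2))
      ((volume.restrict (Ioc 0 1)).prod (volume.restrict (Ioc 0 1))) := by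
    rw [Measure.prod_restrict]
    exact hcont.aestronglyMeasurable (measurableSet_Ioc.prod measurableSet_Ioc)
  have h5 : ∀ᵐ p ∂((volume.restrict (Ioc (0 : ℝ) 1)).prod (volume.restrict (Ioc (0 : ℝ) 1))),
      ‖k (γ.toFun p.1) (γ'.toFun p.2)‖ ≤ M := by
    rw [Measure.prod_restrict]
    exact (ae_restrict_iff' (measurableSet_Ioc.prod measurableSet_Ioc)).2
      (ae_of_all _ fun p hp => hM _ (hsub p hp))
  have h6 := h3.smul_bdd M h4 h5
  refine h6.congr (ae_of_all _ fun p => ?_)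
  simp only [Function.uncurry, Pi.smul_apply', mul_smul]

/-- The curve run through backwards; it serves to form differences of contours. -/
def reverse (γ : ClosedCurve) : ClosedCurve where
  toFun t := γ.toFun (1 - t)
  closed := by simp [γ.closed]
  continuousOn := γ.continuousOn.comp (by fun_prop) fun t ht => by
    simp only [mem_Icc] at ht ⊢; constructor <;> linarith
  piecewise := by
    obtain ⟨N, t, hmono, ht0, htN, hd⟩ := γ.piecewise
    refine ⟨N, fun k => 1 - t (N - k), fun i j hij => ?_, by simp [htN], by simp [ht0], ?_⟩
    · exact sub_le_sub_left (hmono (Nat.sub_le_sub_left hij N)) 1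
    · intro k hk
      have e : N - (k + 1) + 1 = N - k := by omega
      have h := hd (N - (k + 1)) (by omega)
      rw [e] at h
      refine h.comp (f := fun s : ℝ => 1 - s) (by fun_prop) fun s hs => ?_
      simp only [mem_Icc] at hs ⊢; constructor <;> linarith

theorem reverse_image (γ : ClosedCurve) :
    γ.reverse.toFun '' Icc 0 1 = γ.toFun '' Icc 0 1 := by
  ext z
  constructor
  · rintro ⟨t, ht, rfl⟩
    exact ⟨1 - t, by simp only [mem_Icc] at ht ⊢; constructor <;> linarith, rfl⟩
  · rintro ⟨t, ht, rfl⟩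
    exact ⟨1 - t, by simp only [mem_Icc] at ht ⊢; constructor <;> linarith, by simp [reverse]⟩

theorem reverse_integral (γ : ClosedCurve) (g : ℂ → F) :
    γ.reverse.integral g = -γ.integral g := by
  simp only [integral, reverse, deriv_comp_const_sub, neg_smul, intervalIntegral.integral_neg]
  rw [intervalIntegral.integral_comp_sub_left (fun t => deriv γ.toFun t • g (γ.toFun t)) 1]
  simp

/-- The circle of radius `R` around `0`, run through once counterclockwise. -/
noncomputable def circle (R : ℝ) : ClosedCurve where
  toFun t := circleMap 0 R (2 * Real.pi * t)
  closed := by simp [circleMap]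
  continuousOn := ((continuous_circleMap 0 R).comp (by fun_prop)).continuousOn
  piecewise := by
    refine ⟨1, fun k => if k = 0 then 0 else 1, fun i j hij => ?_, by simp, by simp, ?_⟩
    · rcases i with _ | i
      · simp only [if_true]; split_ifs <;> norm_num
      · have : j ≠ 0 := by omega
        simp [this]
    · intro k hk
      exact ((contDiff_circleMap 0 R).comp (by fun_prop)).contDiffOn

theorem circle_integral (R : ℝ) (g : ℂ → F) : (circle R).integral g = ∮ z in C(0, R), g z := by
  have h := intervalIntegral.smul_integral_comp_mul_left (a := 0) (b := 1)
    (fun θ => deriv (circleMap 0 R) θ • g (circleMap 0 R θ)) (2 * Real.pi)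
  rw [mul_zero, mul_one] at h
  rw [circleIntegral, ← h, ← intervalIntegral.integral_smul, integral]
  refine intervalIntegral.integral_congr fun t _ => ?_
  simp only [circle]
  rw [deriv_comp_mul_left (2 * Real.pi) (circleMap 0 R) t, smul_assoc]

theorem norm_eq_of_mem_circle {R : ℝ} (hR : 0 ≤ R) {z : ℂ}
    (hz : z ∈ (circle R).toFun '' Icc 0 1) : ‖z‖ = R := by
  obtain ⟨t, -, rfl⟩ := hz
  simp [circle, abs_of_nonneg hR]

end ClosedCurve

namespace Contour

variable (Γ : Contour)

theorem image_subset_trace {Γ : Contour} {γ : ClosedCurve} (hγ : γ ∈ Γ) :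
    γ.toFun '' Icc 0 1 ⊆ trace Γ := by
  rintro z ⟨t, ht, rfl⟩
  exact ⟨γ, hγ, t, ht, rfl⟩

theorem trace_cons (γ : ClosedCurve) (Γ : Contour) :
    trace (γ :: Γ) = γ.toFun '' Icc 0 1 ∪ trace Γ := by
  ext z
  simp only [trace, List.mem_cons, mem_ofPred_eq, mem_union, mem_image]
  constructor
  · rintro ⟨γ', rfl | h, h'⟩
    · exact Or.inl h'
    · exact Or.inr ⟨γ', h, h'⟩
  · rintro (h | ⟨γ', h, h'⟩)
    · exact ⟨γ, Or.inl rfl, h⟩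
    · exact ⟨γ', Or.inr h, h'⟩

theorem integral_cons (γ : ClosedCurve) (Γ : Contour) (g : ℂ → F) :
    integral (γ :: Γ) g = γ.integral g + integral Γ g := by
  simp [integral]

theorem integral_nil (g : ℂ → F) : integral [] g = 0 := by
  simp [integral]

theorem isCompact_trace : IsCompact (trace Γ) := by
  induction Γ with
  | nil => convert isCompact_empty (X := ℂ); ext; simp [trace]
  | cons γ Γ ih =>
    rw [trace_cons]
    exact (isCompact_Icc.image_of_continuousOn γ.continuousOn).union ih

theorem integral_congr {Γ : Contour} {g h : ℂ → F} (hgh : ∀ z ∈ trace Γ, g z = h z) :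
    integral Γ g = integral Γ h := by
  unfold integral
  congr 1
  exact List.map_congr_left fun γ hγ =>
    γ.integral_congr fun z hz => hgh z (image_subset_trace hγ hz)

theorem integral_add {Γ : Contour} {g h : ℂ → F} (hg : ContinuousOn g (trace Γ))
    (hh : ContinuousOn h (trace Γ)) :
    integral Γ (fun z => g z + h z) = integral Γ g + integral Γ h := by
  unfold integral
  rw [← List.sum_map_add]
  congr 1
  exact List.map_congr_left fun γ hγ => γ.integral_add (hg.mono (image_subset_trace hγ))
    (hh.mono (image_subset_trace hγ))

theorem integral_smul (c : ℂ) (g : ℂ → F) :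
    integral Γ (fun z => c • g z) = c • integral Γ g := by
  unfold integral
  rw [List.smul_sum, List.map_map]
  congr 1
  exact List.map_congr_left fun γ _ => γ.integral_smul c g

theorem integral_sub {Γ : Contour} {g h : ℂ → F} (hg : ContinuousOn g (trace Γ))
    (hh : ContinuousOn h (trace Γ)) :
    integral Γ (fun z => g z - h z) = integral Γ g - integral Γ h := by
  have h1 := integral_add hg (h := fun z => (-1 : ℂ) • h z) (hh.const_smul (-1 : ℂ))
  rw [integral_smul] at h1
  simpa [sub_eq_add_neg] using h1

theorem integral_clm {G : Type*} [NormedAddCommGroup G] [NormedSpace ℂ G] [CompleteSpace F]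
    [CompleteSpace G] {Γ : Contour} (L : F →L[ℂ] G) {g : ℂ → F}
    (hg : ContinuousOn g (trace Γ)) :
    integral Γ (fun z => L (g z)) = L (integral Γ g) := by
  unfold integral
  rw [map_list_sum, List.map_map]
  congr 1
  exact List.map_congr_left fun γ hγ => γ.integral_clm L (hg.mono (image_subset_trace hγ))

theorem integral_smul_const [CompleteSpace F] {Γ : Contour} {g : ℂ → ℂ}
    (hg : ContinuousOn g (trace Γ)) (x : F) :
    integral Γ (fun z => g z • x) = integral Γ g • x := by
  simpa only [ContinuousLinearMap.toSpanSingleton_apply] using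
    integral_clm (ContinuousLinearMap.toSpanSingleton ℂ x) hg

theorem integral_eq_zero_of_hasDerivAt [CompleteSpace F] {Γ : Contour} {G g : ℂ → F}
    (hg : ContinuousOn g (trace Γ)) (hG : ∀ w ∈ trace Γ, HasDerivAt G (g w) w) :
    integral Γ g = 0 := by
  refine List.sum_eq_zero fun x hx => ?_
  obtain ⟨γ, hγ, rfl⟩ := List.mem_map.1 hx
  exact γ.integral_eq_zero_of_hasDerivAt (hg.mono (image_subset_trace hγ)) fun w hw =>
    hG w (image_subset_trace hγ hw)

theorem exists_norm_integral_le :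
    ∃ C : ℝ, 0 ≤ C ∧ ∀ (g : ℂ → F) (M : ℝ), (∀ w ∈ trace Γ, ‖g w‖ ≤ M) →
      ‖integral Γ g‖ ≤ C * M := by
  induction Γ with
  | nil => exact ⟨0, le_rfl, fun g M _ => by simp [integral_nil]⟩
  | cons γ Γ ih =>
    obtain ⟨C, hC, h⟩ := ih
    obtain ⟨C', hC', h'⟩ := γ.exists_norm_integral_le (F := F)
    refine ⟨C' + C, by positivity, fun g M hM => ?_⟩
    rw [trace_cons] at hM
    rw [integral_cons, add_mul]
    exact (norm_add_le _ _).trans (add_le_add (h' g M fun w hw => hM w (Or.inl hw))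
      (h g M fun w hw => hM w (Or.inr hw)))

theorem continuousOn_integral {S : Set ℂ} (hS : IsCompact S) {g : ℂ → ℂ → F}
    (hg : ContinuousOn (Function.uncurry g) (S ×ˢ trace Γ)) :
    ContinuousOn (fun z => integral Γ (g z)) S := by
  induction Γ with
  | nil => simpa only [integral_nil] using continuousOn_const
  | cons γ Γ ih =>
    rw [trace_cons] at hg
    simp only [integral_cons]
    exact (γ.continuousOn_integral hS (hg.mono (prod_mono_right subset_union_left))).add
      (ih (hg.mono (prod_mono_right subset_union_right)))

theorem differentiableOn_integral {V : Set ℂ} (hV : IsOpen V) {g : ℂ → ℂ → F}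
    (hg : ContinuousOn (Function.uncurry g) (V ×ˢ trace Γ))
    (hd : ∀ w ∈ trace Γ, DifferentiableOn ℂ (fun z => g z w) V) :
    DifferentiableOn ℂ (fun z => integral Γ (g z)) V := by
  induction Γ with
  | nil => simpa only [integral_nil] using differentiableOn_const _
  | cons γ Γ ih =>
    rw [trace_cons] at hg hd
    simp only [integral_cons]
    exact (γ.differentiableOn_integral hV (hg.mono (prod_mono_right subset_union_left))
      fun w hw => hd w (Or.inl hw)).add
      (ih (hg.mono (prod_mono_right subset_union_right)) fun w hw => hd w (Or.inr hw))

theorem integral_curve_integral_swap (γ : ClosedCurve) {k : ℂ → ℂ → F}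
    (hk : ContinuousOn (Function.uncurry k) ((γ.toFun '' Icc 0 1) ×ˢ trace Γ)) :
    γ.integral (fun z => integral Γ (k z)) = integral Γ fun w => γ.integral fun z => k z w := by
  have hγ := isCompact_Icc.image_of_continuousOn γ.continuousOn
  induction Γ with
  | nil => simp [integral_nil, ClosedCurve.integral]
  | cons γ' Γ ih =>
    rw [trace_cons] at hk
    have h1 := hk.mono (prod_mono_right subset_union_left)
    have h2 := hk.mono (prod_mono_right subset_union_right)
    simp only [integral_cons]
    rw [γ.integral_add (γ'.continuousOn_integral hγ h1) (continuousOn_integral Γ hγ h2), ih h2,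
      γ.integral_integral_swap γ' h1]

theorem integral_integral_swap (Γ' : Contour) {k : ℂ → ℂ → F}
    (hk : ContinuousOn (Function.uncurry k) (trace Γ ×ˢ trace Γ')) :
    integral Γ (fun z => integral Γ' (k z)) = integral Γ' fun w => integral Γ fun z => k z w := by
  have hswap : ContinuousOn (Function.uncurry fun w z => k z w) (trace Γ' ×ˢ trace Γ) :=
    hk.comp (f := Prod.swap) continuous_swap.continuousOn fun p hp => ⟨hp.2, hp.1⟩
  induction Γ with
  | nil =>
    simp only [integral_nil]
    exact (List.sum_eq_zero fun x hx => by
      obtain ⟨γ, -, rfl⟩ := List.mem_map.1 hx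
      simp [ClosedCurve.integral]).symm
  | cons γ Γ ih =>
    rw [trace_cons] at hk hswap
    have h1 := hk.mono (prod_mono_left subset_union_left)
    have h2 := hk.mono (prod_mono_left subset_union_right)
    have h3 := hswap.mono (prod_mono_right subset_union_left)
    have h4 := hswap.mono (prod_mono_right subset_union_right)
    simp only [integral_cons]
    rw [integral_add (γ.continuousOn_integral (isCompact_trace Γ') h3)
      (continuousOn_integral Γ (isCompact_trace Γ') h4), ih h2 h4,
      integral_curve_integral_swap Γ' γ h1]

theorem integral_append (Γ' : Contour) (g : ℂ → F) :
    integral (Γ ++ Γ') g = integral Γ g + integral Γ' g := by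
  simp [integral]

theorem integral_map_reverse (g : ℂ → F) :
    integral (Γ.map ClosedCurve.reverse) g = -integral Γ g := by
  induction Γ with
  | nil => simp [integral]
  | cons γ Γ ih =>
    rw [List.map_cons, integral_cons, integral_cons, ih, ClosedCurve.reverse_integral, neg_add]

theorem trace_append_map_reverse (Γ' : Contour) :
    trace (Γ ++ Γ'.map ClosedCurve.reverse) = trace Γ ∪ trace Γ' := by
  induction Γ with
  | nil =>
    induction Γ' with
    | nil => ext; simp [trace]
    | cons γ Γ' ih =>
      rw [List.nil_append] at ih ⊢
      rw [List.map_cons, trace_cons, trace_cons, ih, ClosedCurve.reverse_image,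
        union_left_comm]
  | cons γ Γ ih => rw [List.cons_append, trace_cons, trace_cons, ih, union_assoc]

end Contour

end CurveIntegrals

/-! ### The homology version of Cauchy's theorem -/

section Cauchy

variable {F : Type*} [NormedAddCommGroup F] [NormedSpace ℂ F]

namespace Contour

variable {Γ Γ' : Contour}

theorem windingNumber_eq_iff {w c : ℂ} :
    windingNumber Γ w = c ↔ integral Γ (fun z => (z - w)⁻¹) = 2 * Real.pi * Complex.I * c := by
  rw [windingNumber, inv_mul_eq_iff_eq_mul₀ Complex.two_pi_I_ne_zero]

theorem continuousOn_inv_sub {z : ℂ} (hz : z ∉ trace Γ) :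
    ContinuousOn (fun w => (w - z)⁻¹) (trace Γ) :=
  (continuousOn_id.sub continuousOn_const).inv₀ fun w hw h => hz
    ((sub_eq_zero.1 h : w = z) ▸ hw)

/-- The winding number is locally constant: the difference of two nearby Cauchy kernels has a
logarithm as primitive. -/
theorem integral_inv_sub_eq_of_mem_ball {z₀ z : ℂ} {δ : ℝ} (hδ : ∀ w ∈ trace Γ, δ ≤ dist w z₀)
    (hz : z ∈ Metric.ball z₀ δ) :
    integral Γ (fun w => (w - z)⁻¹) = integral Γ fun w => (w - z₀)⁻¹ := by
  have hlt : ∀ w ∈ trace Γ, ‖z - z₀‖ < ‖w - z₀‖ := fun w hw => by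
    rw [← dist_eq_norm, ← dist_eq_norm]; exact (Metric.mem_ball.1 hz).trans_le (hδ w hw)
  have hw0 : ∀ w ∈ trace Γ, w - z₀ ≠ 0 := fun w hw =>
    norm_pos_iff.1 ((norm_nonneg _).trans_lt (hlt w hw))
  have hwz : ∀ w ∈ trace Γ, w - z ≠ 0 := fun w hw h => by
    have := hlt w hw
    rw [sub_eq_zero.1 h] at this
    exact lt_irrefl _ this
  have hc := continuousOn_inv_sub (Γ := Γ) (z := z) fun h => hwz z h (sub_self z)
  have hc0 := continuousOn_inv_sub (Γ := Γ) (z := z₀) fun h => hw0 z₀ h (sub_self z₀)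
  rw [← sub_eq_zero, ← integral_sub hc hc0]
  refine integral_eq_zero_of_hasDerivAt (G := fun w => Complex.log (1 + -(z - z₀) / (w - z₀)))
    (hc.sub hc0) fun w hw => ?_
  have hn : ‖-(z - z₀) / (w - z₀)‖ < 1 := by
    rw [norm_div, norm_neg, div_lt_one ((norm_nonneg _).trans_lt (hlt w hw))]
    exact hlt w hw
  have h1 : HasDerivAt (fun w => 1 + -(z - z₀) / (w - z₀))
      ((0 * (w - z₀) - -(z - z₀) * 1) / (w - z₀) ^ 2) w :=
    ((hasDerivAt_const w (-(z - z₀))).div ((hasDerivAt_id w).sub_const z₀) (hw0 w hw)).const_add 1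
  refine (h1.clog (Complex.mem_slitPlane_of_norm_lt_one hn)).congr_deriv ?_
  have e : 1 + -(z - z₀) / (w - z₀) = (w - z) / (w - z₀) := by
    field_simp [hw0 w hw]; ring
  have h2 := hw0 w hw
  have h3 := hwz w hw
  rw [e]
  field_simp
  ring

/-- A contour does not wind around points outside a disc that contains it. -/
theorem integral_inv_sub_eq_zero_of_norm_le {ρ : ℝ} (hρ : ∀ w ∈ trace Γ, ‖w‖ < ρ) {z : ℂ}
    (hz : ρ ≤ ‖z‖) : integral Γ (fun w => (w - z)⁻¹) = 0 := by
  have hlt : ∀ w ∈ trace Γ, ‖w‖ < ‖z‖ := fun w hw => (hρ w hw).trans_le hz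
  refine integral_eq_zero_of_hasDerivAt (G := fun w => Complex.log (1 + -w / z))
    (continuousOn_inv_sub fun h => (hlt z h).ne rfl) fun w hw => ?_
  have hz0 : z ≠ 0 := norm_pos_iff.1 ((norm_nonneg _).trans_lt (hlt w hw))
  have hwz : w - z ≠ 0 := fun h => (hlt w hw).ne (by rw [sub_eq_zero.1 h])
  have hn : ‖-w / z‖ < 1 := by
    rw [norm_div, norm_neg, div_lt_one (norm_pos_iff.2 hz0)]
    exact hlt w hw
  have h1 : HasDerivAt (fun w => 1 + -w / z) (-1 / z) w :=
    ((hasDerivAt_id w).neg.div_const z).const_add 1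
  refine (h1.clog (Complex.mem_slitPlane_of_norm_lt_one hn)).congr_deriv ?_
  have e : 1 + -w / z = -(w - z) / z := by field_simp; ring
  rw [e]
  field_simp

variable [CompleteSpace F] {V : Set ℂ} {φ : ℂ → F}

/-- Off the contour, the integral of a slope is a Cauchy integral plus a multiple of the winding
number. -/
theorem integral_dslope_of_notMem {z : ℂ} (hφ : ContinuousOn φ (trace Γ)) (hz : z ∉ trace Γ) :
    integral Γ (dslope φ z) = integral Γ (fun w => (w - z)⁻¹ • φ w) -
      (integral Γ fun w => (w - z)⁻¹) • φ z := by
  have hc := continuousOn_inv_sub hz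
  rw [← integral_smul_const hc,
    ← integral_sub (g := fun w => (w - z)⁻¹ • φ w) (h := fun w => (w - z)⁻¹ • φ z)
    (hc.smul hφ) (hc.smul continuousOn_const)]
  refine integral_congr fun w hw => ?_
  rw [dslope_eq_smul _ (ne_of_mem_of_not_mem hw hz), smul_sub]

/-- Dixon's form of Cauchy's theorem. The integral of the slopes extends to an entire function that
vanishes at infinity, by the Cauchy integral `∫_Γ φ(w) (w - z)⁻¹ dw` outside `V`. -/
theorem integral_dslope_eq_zero (hV : IsOpen V) (hφ : DifferentiableOn ℂ φ V)
    (hΓ : trace Γ ⊆ V) (hw : ∀ w ∉ V, windingNumber Γ w = 0) {z : ℂ} (hz : z ∈ V) :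
    integral Γ (dslope φ z) = 0 := by
  classical
  have hφc : ContinuousOn φ (trace Γ) := hφ.continuousOn.mono hΓ
  -- Both formulas agree at all points off the contour with winding number `0`, an open set that
  -- together with `V` covers the plane.
  let H : ℂ → F := fun z =>
    if z ∈ V then integral Γ (dslope φ z) else integral Γ fun w => (w - z)⁻¹ • φ w
  have hH : ∀ z ∉ trace Γ, integral Γ (fun w => (w - z)⁻¹) = 0 →
      H z = integral Γ fun w => (w - z)⁻¹ • φ w := by
    intro z hz h0
    by_cases hzV : z ∈ V
    · simp only [H, if_pos hzV, integral_dslope_of_notMem hφc hz, h0, zero_smul, sub_zero]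
    · simp only [H, if_neg hzV]
  have hd1 : DifferentiableOn ℂ (fun z => integral Γ (dslope φ z)) V :=
    differentiableOn_integral Γ hV ((continuousOn_dslope_prod hV hφ).mono (prod_mono_right hΓ))
      fun w hw => differentiableOn_dslope_left hV hφ (hΓ hw)
  have hd2 : DifferentiableOn ℂ (fun z => integral Γ fun w => (w - z)⁻¹ • φ w) (trace Γ)ᶜ := by
    refine differentiableOn_integral Γ (isCompact_trace Γ).isClosed.isOpen_compl ?_ fun w hw => ?_
    · refine ContinuousOn.smul (ContinuousOn.inv₀ (by fun_prop) fun p hp h => ?_)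
        (hφc.comp continuousOn_snd fun p hp => hp.2)
      exact hp.1 (sub_eq_zero.1 h ▸ hp.2)
    · refine DifferentiableOn.smul_const (DifferentiableOn.inv (by fun_prop) fun z hz h => ?_) _
      exact hz (sub_eq_zero.1 h ▸ hw)
  have hHd : Differentiable ℂ H := by
    intro z
    by_cases hzV : z ∈ V
    · refine (hd1.differentiableAt (hV.mem_nhds hzV)).congr_of_eventuallyEq ?_
      filter_upwards [hV.mem_nhds hzV] with y hy
      simp only [H, if_pos hy]
    · have hzΓ : z ∉ trace Γ := fun h => hzV (hΓ h)
      have hopen := (isCompact_trace Γ).isClosed.isOpen_compl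
      obtain ⟨δ, hδ, hδΓ⟩ := Metric.isOpen_iff.1 hopen z hzΓ
      refine (hd2.differentiableAt (hopen.mem_nhds hzΓ)).congr_of_eventuallyEq ?_
      filter_upwards [Metric.ball_mem_nhds z hδ] with y hy
      refine hH y (hδΓ hy) ?_
      rw [integral_inv_sub_eq_of_mem_ball (fun w hw => ?_) hy,
        windingNumber_eq_iff.1 (hw z hzV), mul_zero]
      by_contra! hlt
      exact hδΓ hlt hw
  obtain ⟨ρ, hρ⟩ := (isCompact_trace Γ).isBounded.exists_norm_le
  obtain ⟨M, hM⟩ := (isCompact_trace Γ).exists_bound_of_continuousOn hφc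
  obtain ⟨C, hC, hCΓ⟩ := exists_norm_integral_le (F := F) Γ
  have hHt : Tendsto H (cocompact ℂ) (𝓝 0) := by
    rw [← Metric.cobounded_eq_cocompact]
    have hlim : Tendsto (fun z : ℂ => C * (M / (‖z‖ - ρ))) (Bornology.cobounded ℂ) (𝓝 0) := by
      have h1 : Tendsto (fun z : ℂ => ‖z‖ - ρ) (Bornology.cobounded ℂ) atTop :=
        tendsto_atTop_add_const_right _ _ tendsto_norm_cobounded_atTop
      simpa using (h1.const_div_atTop M).const_mul C
    refine squeeze_zero_norm' ?_ hlim
    filter_upwards [tendsto_norm_cobounded_atTop.eventually_gt_atTop ρ] with y hy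
    have hyΓ : y ∉ trace Γ := fun h => (hρ y h).not_gt hy
    have h0 : integral Γ (fun w => (w - y)⁻¹) = 0 := by
      refine integral_inv_sub_eq_zero_of_norm_le (ρ := ‖y‖) (fun w hw => (hρ w hw).trans_lt hy)
        le_rfl
    rw [hH y hyΓ h0]
    refine hCΓ _ _ fun w hw => ?_
    have hpos : 0 < ‖y‖ - ρ := sub_pos.2 hy
    have hle : ‖y‖ - ρ ≤ ‖w - y‖ := by
      rw [norm_sub_rev]
      linarith [norm_sub_norm_le y w, hρ w hw]
    rw [norm_smul, norm_inv, div_eq_inv_mul]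
    exact mul_le_mul (inv_anti₀ hpos hle) (hM w hw) (norm_nonneg _) (inv_nonneg.2 hpos.le)
  have h := hHd.apply_eq_of_tendsto_cocompact z hHt
  simpa only [H, if_pos hz] using h

/-- Cauchy's theorem: the integral of a holomorphic function vanishes along a contour that does not
wind around any point outside the domain. -/
theorem integral_eq_zero (hV : IsOpen V) (hφ : DifferentiableOn ℂ φ V)
    (hΓ : trace Γ ⊆ V) (hw : ∀ w ∉ V, windingNumber Γ w = 0) : integral Γ φ = 0 := by
  rcases (trace Γ).eq_empty_or_nonempty with h | ⟨z, hz⟩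
  · rw [integral_congr (h := fun _ => (0 : ℂ) • (0 : F)) fun z hz => by simp [h] at hz,
      integral_smul, zero_smul]
  have hzV := hΓ hz
  -- `φ` is itself a slope, namely that of `w ↦ (w - z) φ(w)` at `z`.
  have hd : DifferentiableOn ℂ (fun w => (w - z) • φ w) V :=
    DifferentiableOn.smul (by fun_prop) hφ
  rw [← integral_dslope_eq_zero hV hd hΓ hw hzV]
  refine integral_congr fun w hw => ?_
  rcases eq_or_ne w z with rfl | hwz
  · have h1 := ((hasDerivAt_id w).sub_const w).smul
      (hφ.differentiableAt (hV.mem_nhds hzV)).hasDerivAt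
    rw [dslope_same]
    have h2 : HasDerivAt (fun x => (x - w) • φ x) _ w := h1
    rw [h2.deriv]
    simp
  · rw [dslope_sub_smul_of_ne _ hwz]

theorem integral_eq_of_windingNumber_eq (hV : IsOpen V) (hφ : DifferentiableOn ℂ φ V)
    (hΓ : trace Γ ⊆ V) (hΓ' : trace Γ' ⊆ V)
    (hw : ∀ w ∉ V, windingNumber Γ w = windingNumber Γ' w) : integral Γ φ = integral Γ' φ := by
  have h := integral_eq_zero (Γ := Γ ++ Γ'.map ClosedCurve.reverse) hV hφ
    (by rw [trace_append_map_reverse]; exact union_subset hΓ hΓ') fun w hwV => by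
      have := hw w hwV
      unfold windingNumber at this ⊢
      rw [integral_append, integral_map_reverse, mul_add, this]
      ring
  rwa [integral_append, integral_map_reverse, add_neg_eq_zero] at h

/-- The integral around the singularities of a function that decays quadratically at infinity
vanishes: the contour may be replaced by arbitrarily large circles. -/
theorem integral_eq_zero_of_isBigO {K : Set ℂ} (hK : IsCompact K) (hφ : DifferentiableOn ℂ φ Kᶜ)
    (hΓ : trace Γ ⊆ Kᶜ) (hw : ∀ w ∈ K, windingNumber Γ w = 1)
    (hO : φ =O[Bornology.cobounded ℂ] fun z => (z⁻¹) ^ 2) : integral Γ φ = 0 := by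
  obtain ⟨C, hC, hCb⟩ := hO.exists_pos
  obtain ⟨R₀, -, hR₀⟩ := hasBasis_cobounded_norm.mem_iff.1 hCb.bound
  obtain ⟨ρ, hρ⟩ := hK.isBounded.exists_norm_le
  have hb : ∀ᶠ R : ℝ in atTop, ‖integral Γ φ‖ ≤ 2 * Real.pi * C / R := by
    filter_upwards [eventually_ge_atTop R₀, eventually_gt_atTop ρ, eventually_gt_atTop 0]
      with R h1 h2 h3
    have htr : trace [ClosedCurve.circle R] = (ClosedCurve.circle R).toFun '' Icc 0 1 := by
      rw [trace_cons]; simp [trace]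
    have heq : integral Γ φ = integral [ClosedCurve.circle R] φ := by
      refine integral_eq_of_windingNumber_eq hK.isClosed.isOpen_compl hφ hΓ ?_ fun w hwK => ?_
      · rw [htr]
        intro z hz hzK
        have := ClosedCurve.norm_eq_of_mem_circle h3.le hz
        linarith [hρ z hzK]
      · rw [hw w (not_not.1 hwK), eq_comm, windingNumber_eq_iff, integral_cons, integral_nil,
          add_zero, ClosedCurve.circle_integral, mul_one]
        refine circleIntegral.integral_sub_inv_of_mem_ball ?_
        rw [mem_ball_zero_iff]
        exact (hρ w (not_not.1 hwK)).trans_lt h2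
    rw [heq, integral_cons, integral_nil, add_zero, ClosedCurve.circle_integral]
    refine (circleIntegral.norm_integral_le_of_norm_le_const (C := C / R ^ 2) h3.le
      fun z hz => ?_).trans_eq (by field_simp)
    have hzR : ‖z‖ = R := mem_sphere_zero_iff_norm.1 hz
    have := hR₀ (show z ∈ {x | R₀ ≤ ‖x‖} from h1.trans_eq hzR.symm)
    rw [mem_ofPred_eq, norm_pow, norm_inv, hzR] at this
    rwa [div_eq_mul_inv, ← inv_pow]
  have hlim : Tendsto (fun R : ℝ => 2 * Real.pi * C / R) atTop (𝓝 0) :=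
    tendsto_id.const_div_atTop _
  exact norm_le_zero_iff.1 (ge_of_tendsto hlim hb)

end Contour

end Cauchy

/-! ### Contour integrals of resolvents -/

section Resolvents

variable {𝔸 : Type*} [NormedRing 𝔸] [NormedAlgebra ℂ 𝔸]

theorem resolvent_mul_sub {a : 𝔸} {z : ℂ} (hz : z ∉ spectrum ℂ a) :
    resolvent a z * (algebraMap ℂ 𝔸 z - a) = 1 :=
  Ring.inverse_mul_cancel _ (not_not.1 hz)

theorem sub_mul_resolvent {a : 𝔸} {z : ℂ} (hz : z ∉ spectrum ℂ a) :
    (algebraMap ℂ 𝔸 z - a) * resolvent a z = 1 :=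
  Ring.mul_inverse_cancel _ (not_not.1 hz)

/-- The resolvent identity. -/
theorem resolvent_eq_add {a : 𝔸} {z w : ℂ} (hz : z ∉ spectrum ℂ a) (hw : w ∉ spectrum ℂ a) :
    resolvent a z = resolvent a w + (w - z) • (resolvent a z * resolvent a w) := by
  have h1 : resolvent a z * ((algebraMap ℂ 𝔸 w - a) * resolvent a w) = resolvent a z := by
    rw [sub_mul_resolvent hw, mul_one]
  have h2 : resolvent a z * (algebraMap ℂ 𝔸 z - a) * resolvent a w = resolvent a w := by
    rw [resolvent_mul_sub hz, one_mul]
  nth_rw 1 [← h1]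
  nth_rw 2 [← h2]
  simp only [Algebra.algebraMap_eq_smul_one, mul_sub, sub_mul, smul_mul_assoc, one_mul,
    mul_smul_comm, mul_one, sub_smul, mul_assoc]
  abel

variable [CompleteSpace 𝔸]

theorem differentiableOn_resolvent (a : 𝔸) : DifferentiableOn ℂ (resolvent a) (spectrum ℂ a)ᶜ :=
  fun _ hz => (spectrum.hasDerivAt_resolvent_const_left
    (not_not.1 hz)).differentiableAt.differentiableWithinAt

theorem isBigO_inv_sub (c : ℂ) :
    (fun z : ℂ => (z - c)⁻¹) =O[Bornology.cobounded ℂ] fun z => z⁻¹ := by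
  have h := spectrum.resolvent_isBigO_inv (𝕜 := ℂ) c
  refine h.congr_left fun z => ?_
  simp [resolvent, Ring.inverse_eq_inv']

namespace Contour

variable {Γ : Contour} {U : Set ℂ}

theorem Surrounds.mono {K K' : Set ℂ} (h : Γ.Surrounds K U) (hK : K' ⊆ K) : Γ.Surrounds K' U :=
  ⟨h.1.trans (sdiff_subset_sdiff_right hK), fun w hw => h.2.1 w (hK hw), h.2.2⟩

theorem Surrounds.trace_subset {K : Set ℂ} (h : Γ.Surrounds K U) : trace Γ ⊆ U :=
  h.1.trans sdiff_subset

theorem Surrounds.trace_subset_compl {K : Set ℂ} (h : Γ.Surrounds K U) : trace Γ ⊆ Kᶜ :=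
  fun _ hz => (h.1 hz).2

/-- The holomorphic functional calculus sends the constant function `1` to the unit. -/
theorem integral_resolvent [Nontrivial 𝔸] {a : 𝔸} (hΓ : Γ.Surrounds (spectrum ℂ a) U) :
    integral Γ (resolvent a) = (2 * Real.pi * Complex.I : ℂ) • (1 : 𝔸) := by
  obtain ⟨c, hc⟩ := spectrum.nonempty a
  have hne : ∀ z ∉ spectrum ℂ a, z - c ≠ 0 := fun z hz h => hz (sub_eq_zero.1 h ▸ hc)
  have hd : DifferentiableOn ℂ (fun z : ℂ => (z - c)⁻¹) (spectrum ℂ a)ᶜ :=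
    DifferentiableOn.inv (by fun_prop) fun z hz => hne z hz
  have hsub := hΓ.trace_subset_compl
  have hR := differentiableOn_resolvent a
  -- `R(z) - (z - c)⁻¹ = (z - c)⁻¹ R(z) (a - c)` decays quadratically.
  have h0 : integral Γ (fun z => resolvent a z - (z - c)⁻¹ • (1 : 𝔸)) = 0 := by
    refine integral_eq_zero_of_isBigO (spectrum.isCompact a) (hR.sub (hd.smul_const 1)) hsub
      hΓ.2.1 ?_
    have hO : (fun z => ((z - c)⁻¹ • resolvent a z) * (a - algebraMap ℂ 𝔸 c))
        =O[Bornology.cobounded ℂ] fun z => (z⁻¹) ^ 2 := by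
      have h1 := (isBigO_inv_sub c).smul (spectrum.resolvent_isBigO_inv a)
      have h2 := h1.mul (Asymptotics.isBigO_const_const (a - algebraMap ℂ 𝔸 c)
        (one_ne_zero (α := ℂ)) (Bornology.cobounded ℂ))
      refine h2.congr_right fun z => ?_
      simp [sq]
    refine hO.congr' ?_ EventuallyEq.rfl
    have hb : ∀ᶠ z in Bornology.cobounded ℂ, z ∉ spectrum ℂ a :=

      Bornology.isBounded_def.1 (spectrum.isCompact (𝕜 := ℂ) a).isBounded
    filter_upwards [hb] with z hz
    have e : a - algebraMap ℂ 𝔸 c = (z - c) • (1 : 𝔸) - (algebraMap ℂ 𝔸 z - a) := by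
      simp only [Algebra.algebraMap_eq_smul_one, sub_smul]; abel
    rw [e, mul_sub, smul_mul_assoc _ (resolvent a z) (algebraMap ℂ 𝔸 z - a), resolvent_mul_sub hz,
      mul_smul_comm, mul_one, smul_smul, mul_inv_cancel₀ (hne z hz), one_smul]
  have hdc : ContinuousOn (fun z : ℂ => (z - c)⁻¹) (trace Γ) := hd.continuousOn.mono hsub
  rw [integral_sub (hR.continuousOn.mono hsub) (h := fun z => (z - c)⁻¹ • (1 : 𝔸))
    (hdc.smul continuousOn_const), sub_eq_zero,
    integral_smul_const hdc, windingNumber_eq_iff.1 (hΓ.2.1 c hc), mul_one] at h0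
  exact h0

/-- The functional calculus turns the slope of `f` at a point `w` outside the spectrum into
`(f(w) - f(a)) (w - a)⁻¹`, where `f(a)` is given by the contour integral. -/
theorem integral_dslope_smul_resolvent [Nontrivial 𝔸] {a : 𝔸} (hU : IsOpen U) {f : ℂ → ℂ}
    (hf : DifferentiableOn ℂ f U) (hΓ : Γ.Surrounds (spectrum ℂ a) U) {w : ℂ} (hw : w ∈ U)
    (hwa : w ∉ spectrum ℂ a) :
    integral Γ (fun z => dslope f z w • resolvent a z) =
      (2 * Real.pi * Complex.I * f w) • resolvent a w -
        integral Γ (fun z => f z • resolvent a z) * resolvent a w := by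
  have hsub := hΓ.trace_subset_compl
  have hR : ContinuousOn (resolvent a) (trace Γ) :=
    (differentiableOn_resolvent a).continuousOn.mono hsub
  have hfc : ContinuousOn f (trace Γ) := hf.continuousOn.mono hΓ.trace_subset
  have hdc : ContinuousOn (dslope f w) (trace Γ) :=
    ((Complex.differentiableOn_dslope (hU.mem_nhds hw)).2 hf).continuousOn.mono hΓ.trace_subset
  have hg : ContinuousOn (fun z => f w • resolvent a z - f z • resolvent a z) (trace Γ) :=
    (hR.const_smul _).sub (hfc.smul hR)
  have key : ∀ z ∈ trace Γ, dslope f z w • resolvent a z = dslope f w z • resolvent a w +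
      (ContinuousLinearMap.mul ℂ 𝔸).flip (resolvent a w)
        (f w • resolvent a z - f z • resolvent a z) := by
    intro z hz
    have hs := sub_smul_dslope f w z
    rw [smul_eq_mul] at hs
    rw [dslope_comm]
    nth_rw 1 [resolvent_eq_add (hsub hz) hwa]
    rw [smul_add, smul_smul, ContinuousLinearMap.flip_apply, ContinuousLinearMap.mul_apply',
      ← sub_smul, smul_mul_assoc]
    congr 2
    linear_combination -hs
  rw [integral_congr key, integral_add (g := fun z => dslope f w z • resolvent a w)
    (h := fun z => (ContinuousLinearMap.mul ℂ 𝔸).flip (resolvent a w)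
      (f w • resolvent a z - f z • resolvent a z)) (hdc.smul continuousOn_const)
    (((ContinuousLinearMap.mul ℂ 𝔸).flip (resolvent a w)).continuous.comp_continuousOn hg),
    integral_smul_const hdc, integral_dslope_eq_zero hU hf hΓ.trace_subset hΓ.2.2 hw, zero_smul,
    zero_add, integral_clm _ hg, integral_sub (g := fun z => f w • resolvent a z)
    (h := fun z => f z • resolvent a z) (hR.const_smul _) (hfc.smul hR), integral_smul,
    integral_resolvent hΓ, ContinuousLinearMap.flip_apply, ContinuousLinearMap.mul_apply', sub_mul,
    smul_smul, smul_mul_assoc, one_mul, mul_comm (f w)]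

end Contour

end Resolvents

/-! ### Integrals of resolvent products -/

section Diagonal

variable {n : ℕ} {E : Fin n → Type*} [∀ i, NormedAddCommGroup (E i)] [∀ i, NormedSpace ℂ (E i)]

/-- Passage to a diagonal entry is an algebra homomorphism on lower triangular matrices, so it does
not enlarge the spectrum. -/
theorem spectrum_diag_subset_causalSpectrum (A : lowerTriangular E) (k : Fin n) :
    spectrum ℂ ((A : BlockMatrix E) k k) ⊆ causalSpectrum A := by
  have hmul : ∀ S T : lowerTriangular E,
      ((S * T : lowerTriangular E) : BlockMatrix E) k k =
        (S : BlockMatrix E) k k * (T : BlockMatrix E) k k := by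
    intro S T
    rw [MulMemClass.coe_mul, BlockMatrix.mul_entry, Finset.sum_eq_single k]
    · rfl
    · intro j _ hj
      rcases lt_or_gt_of_ne hj with h | h
      · rw [T.2 j k h, ContinuousLinearMap.comp_zero]
      · rw [S.2 k j h, ContinuousLinearMap.zero_comp]
    · simp
  let φ : lowerTriangular E →ₐ[ℂ] (E k →L[ℂ] E k) :=
    AlgHom.ofLinearMap
      { toFun := fun S => (S : BlockMatrix E) k k
        map_add' := fun _ _ => rfl
        map_smul' := fun _ _ => rfl } (BlockMatrix.one_entry_self k) hmul
  exact AlgHom.spectrum_apply_subset φ A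

end Diagonal

section ResolventProducts

open ContinuousLinearMap (compL)

/-- The induction step for the multiple integral: a contour integral of slopes, integrated against
a further resolvent, is a single contour integral. -/
theorem integral_resolvent_comp_integral_dslope {E₀ E₁ E₂ G : Type*}
    [NormedAddCommGroup E₀] [NormedSpace ℂ E₀] [CompleteSpace E₀] [Nontrivial E₀]
    [NormedAddCommGroup E₁] [NormedSpace ℂ E₁] [CompleteSpace E₁]
    [NormedAddCommGroup E₂] [NormedSpace ℂ E₂]
    [NormedAddCommGroup G] [NormedSpace ℂ G] [CompleteSpace G]
    {U : Set ℂ} (hU : IsOpen U) {f : ℂ → ℂ} (hf : DifferentiableOn ℂ f U)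
    {a : E₀ →L[ℂ] E₀} (T : E₁ →L[ℂ] E₀) {P : ℂ → E₂ →L[ℂ] E₁} {Γ₀ Γ : Contour}
    (hΓ₀ : Γ₀.Surrounds (spectrum ℂ a) U) (hΓ : Γ.trace ⊆ U \ spectrum ℂ a)
    (hP : ContinuousOn P Γ.trace)
    (h0 : Γ.integral (fun w => ((resolvent a w).comp T).comp (P w)) = 0)
    (L : (E₂ →L[ℂ] E₀) →L[ℂ] G) :
    Γ₀.integral (fun z =>
        L (((resolvent a z).comp T).comp (Γ.integral fun w => dslope f z w • P w))) =
      (2 * Real.pi * Complex.I : ℂ) •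
        L (Γ.integral fun w => f w • ((resolvent a w).comp T).comp (P w)) := by
  have hR := (differentiableOn_resolvent a).continuousOn
  have hR₀ : ContinuousOn (resolvent a) Γ₀.trace := hR.mono hΓ₀.trace_subset_compl
  have hRΓ : ContinuousOn (resolvent a) Γ.trace := hR.mono fun z hz => (hΓ hz).2
  have hΓU : Γ.trace ⊆ U := hΓ.trans sdiff_subset
  have hs : ContinuousOn (fun p : ℂ × ℂ => dslope f p.1 p.2) (Γ₀.trace ×ˢ Γ.trace) :=
    (continuousOn_dslope_prod hU hf).mono (prod_mono hΓ₀.trace_subset hΓU)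
  have hRTP : ContinuousOn (fun w => ((resolvent a w).comp T).comp (P w)) Γ.trace :=
    (hRΓ.clm_comp continuousOn_const).clm_comp hP
  have hk : ContinuousOn
      (Function.uncurry fun z w => dslope f z w • L (((resolvent a z).comp T).comp (P w)))
      (Γ₀.trace ×ˢ Γ.trace) := by
    refine hs.smul (L.continuous.comp_continuousOn (ContinuousOn.clm_comp (ContinuousOn.clm_comp
      (hR₀.comp continuousOn_fst fun p hp => hp.1) continuousOn_const)
      (hP.comp continuousOn_snd fun p hp => hp.2)))
  have h1 : ∀ z ∈ Γ₀.trace,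
      L (((resolvent a z).comp T).comp (Γ.integral fun w => dslope f z w • P w)) =
        Γ.integral fun w => dslope f z w • L (((resolvent a z).comp T).comp (P w)) := by
    intro z hz
    have hc : ContinuousOn (fun w => dslope f z w • P w) Γ.trace :=
      (hs.comp (f := fun w => (z, w)) (by fun_prop) fun w hw => ⟨hz, hw⟩).smul hP
    have := Contour.integral_clm (L.comp (compL ℂ E₂ E₁ E₀ ((resolvent a z).comp T))) hc
    simpa only [map_smul, ContinuousLinearMap.comp_apply, ContinuousLinearMap.compL_apply]
      using this.symm
  rw [Contour.integral_congr h1, Contour.integral_integral_swap _ _ hk]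
  -- `S` is `2πi f(a)` in the functional calculus; its contribution is annihilated by `h0`.
  set S : E₀ →L[ℂ] E₀ := Γ₀.integral fun z => f z • resolvent a z
  have h2 : ∀ w ∈ Γ.trace,
      (Γ₀.integral fun z => dslope f z w • L (((resolvent a z).comp T).comp (P w))) =
        (2 * Real.pi * Complex.I : ℂ) • L (f w • ((resolvent a w).comp T).comp (P w)) -
          (L.comp (compL ℂ E₂ E₀ E₀ S)) (((resolvent a w).comp T).comp (P w)) := by
    intro w hw
    have hc : ContinuousOn (fun z => dslope f z w • resolvent a z) Γ₀.trace :=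
      (hs.comp (f := fun z => (z, w)) (by fun_prop) fun z hz => ⟨hz, hw⟩).smul hR₀
    have := Contour.integral_clm (L.comp ((compL ℂ E₂ E₀ E₀).flip (T.comp (P w)))) hc
    rw [Contour.integral_dslope_smul_resolvent hU hf hΓ₀ (hΓU hw) (hΓ hw).2] at this
    simp only [map_smul, map_sub, ContinuousLinearMap.comp_apply, ContinuousLinearMap.compL_apply,
      ContinuousLinearMap.flip_apply] at this
    rw [mul_smul] at this
    rw [map_smul]
    exact this
  have hfc : ContinuousOn f Γ.trace := hf.continuousOn.mono hΓU
  have hc1 : ContinuousOn (fun w => f w • ((resolvent a w).comp T).comp (P w)) Γ.trace :=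
    hfc.smul hRTP
  rw [Contour.integral_congr h2, Contour.integral_sub
    (g := fun w => (2 * Real.pi * Complex.I : ℂ) • L (f w • ((resolvent a w).comp T).comp (P w)))
    (h := fun w => (L.comp (compL ℂ E₂ E₀ E₀ S)) (((resolvent a w).comp T).comp (P w)))
    ((L.continuous.comp_continuousOn hc1).const_smul _)
    ((L.comp (compL ℂ E₂ E₀ E₀ S)).continuous.comp_continuousOn hRTP),
    Contour.integral_smul, Contour.integral_clm L hc1,
    Contour.integral_clm (L.comp (compL ℂ E₂ E₀ E₀ S)) hRTP, h0, map_zero, sub_zero]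

variable {n : ℕ} {E : Fin n → Type*} [∀ i, NormedAddCommGroup (E i)] [∀ i, NormedSpace ℂ (E i)]
  [∀ i, CompleteSpace (E i)]

theorem continuousOn_resolventProduct (A : BlockMatrix E) (m : ℕ) (i : Fin (m + 1) → Fin n) :
    ContinuousOn (resolventProduct A m i)
      (univ.pi fun k => (spectrum ℂ (A (i k) (i k)))ᶜ) := by
  have hR : ContinuousOn (fun μ : Fin (m + 1) → ℂ => resolvent (A (i 0) (i 0)) (μ 0))
      (univ.pi fun k => (spectrum ℂ (A (i k) (i k)))ᶜ) :=
    (differentiableOn_resolvent (A (i 0) (i 0))).continuousOn.comp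
      (f := fun μ : Fin (m + 1) → ℂ => μ 0) (by fun_prop) fun μ hμ => hμ 0 (mem_univ _)
  induction m with
  | zero => exact hR
  | succ m ih =>
    refine (hR.clm_comp continuousOn_const).clm_comp ((ih (Fin.tail i) ?_).comp
      (f := fun μ : Fin (m + 2) → ℂ => Fin.tail μ) (by unfold Fin.tail; fun_prop)
      fun μ hμ k _ => hμ k.succ (mem_univ _))
    exact (differentiableOn_resolvent (A (Fin.tail i 0) (Fin.tail i 0))).continuousOn.comp
      (f := fun μ : Fin (m + 1) → ℂ => μ 0) (by fun_prop) fun μ hμ => hμ 0 (mem_univ _)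

theorem differentiableOn_resolventProduct (A : BlockMatrix E) (m : ℕ) (i : Fin (m + 1) → Fin n) :
    DifferentiableOn ℂ (fun z => resolventProduct A m i fun _ => z)
      (⋃ k, spectrum ℂ (A (i k) (i k)))ᶜ := by
  have hsub : ∀ k, (⋃ k, spectrum ℂ (A (i k) (i k)))ᶜ ⊆ (spectrum ℂ (A (i k) (i k)))ᶜ := fun k =>
    compl_subset_compl.2 (subset_iUnion (fun k => spectrum ℂ (A (i k) (i k))) k)
  have hR := (differentiableOn_resolvent (A (i 0) (i 0))).mono (hsub 0)
  induction m with
  | zero => exact hR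
  | succ m ih =>
    have h := ih (Fin.tail i) (fun k => compl_subset_compl.2
      (subset_iUnion (fun k => spectrum ℂ (A (Fin.tail i k) (Fin.tail i k))) k))
      ((differentiableOn_resolvent (A (Fin.tail i 0) (Fin.tail i 0))).mono
        (compl_subset_compl.2
          (subset_iUnion (fun k => spectrum ℂ (A (Fin.tail i k) (Fin.tail i k))) 0)))
    refine (hR.clm_comp (differentiableOn_const _)).clm_comp (h.mono (compl_subset_compl.2 ?_))
    exact iUnion_subset fun k => subset_iUnion (fun k => spectrum ℂ (A (i k) (i k))) k.succ

theorem isBigO_resolventProduct_succ (A : BlockMatrix E) (m : ℕ) (i : Fin (m + 2) → Fin n)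
    (h : (fun z => resolventProduct A m (Fin.tail i) fun _ => z)
      =O[Bornology.cobounded ℂ] fun z => z⁻¹) :
    (fun z => resolventProduct A (m + 1) i fun _ => z)
      =O[Bornology.cobounded ℂ] fun z => (z⁻¹) ^ 2 := by
  have hR := spectrum.resolvent_isBigO_inv (𝕜 := ℂ) (A (i 0) (i 0))
  have h1 : (fun z => resolventProduct A (m + 1) i fun _ => z) =O[Bornology.cobounded ℂ]
      fun z => ‖A (i 0) (i 1)‖ * (‖resolvent (A (i 0) (i 0)) z‖ *
        ‖resolventProduct A m (Fin.tail i) fun _ => z‖) := by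
    refine Asymptotics.IsBigO.of_norm_le fun z => ?_
    refine (ContinuousLinearMap.opNorm_comp_le _ _).trans ?_
    rw [← mul_assoc, mul_comm ‖A (i 0) (i 1)‖]
    exact mul_le_mul_of_nonneg_right (ContinuousLinearMap.opNorm_comp_le _ _) (norm_nonneg _)
  refine h1.trans ((hR.norm_left.mul h.norm_left).const_mul_left _ |>.congr_right fun z => ?_)
  rw [sq]

theorem isBigO_resolventProduct (A : BlockMatrix E) (m : ℕ) (i : Fin (m + 1) → Fin n) :
    (fun z => resolventProduct A m i fun _ => z) =O[Bornology.cobounded ℂ] fun z => z⁻¹ := by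
  induction m with
  | zero => exact spectrum.resolvent_isBigO_inv (𝕜 := ℂ) (A (i 0) (i 0))
  | succ m ih =>
    refine (isBigO_resolventProduct_succ A m i (ih _)).trans ?_
    have h1 : (fun z : ℂ => z⁻¹) =O[Bornology.cobounded ℂ] fun _ => (1 : ℂ) :=
      (tendsto_inv₀_cobounded (α := ℂ)).isBigO_one ℂ
    simpa [sq] using h1.mul (Asymptotics.isBigO_refl (fun z : ℂ => z⁻¹) _)

theorem multiIntegral_congr {F : Type*} [NormedAddCommGroup F] [NormedSpace ℂ F] (m : ℕ)
    {Γs : Fin m → Contour} {g h : (Fin m → ℂ) → F}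
    (hgh : ∀ μ ∈ univ.pi fun k => (Γs k).trace, g μ = h μ) :
    multiIntegral m Γs g = multiIntegral m Γs h := by
  induction m with
  | zero => exact hgh _ fun k => k.elim0
  | succ m ih =>
    refine Contour.integral_congr fun z hz => ih fun μ hμ => hgh _ fun k _ => ?_
    refine Fin.cases ?_ (fun k => ?_) k
    · exact hz
    · exact hμ k (mem_univ _)

/-- The multiple integral of a divided difference against a resolvent product reduces to a single
contour integral. The operator `L` absorbs the factors of the variables that are not yet integrated,
which makes the induction on the number of variables possible. -/
theorem multiIntegral_newtonDifference [∀ i, Nontrivial (E i)] (A : BlockMatrix E) {U : Set ℂ}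
    (hU : IsOpen U) {G : Type*} [NormedAddCommGroup G] [NormedSpace ℂ G] [CompleteSpace G]
    (Γ : Contour) (m : ℕ) {f : ℂ → ℂ} (hf : DifferentiableOn ℂ f U) (i : Fin (m + 1) → Fin n)
    (hΓ : ∀ k, Γ.Surrounds (spectrum ℂ (A (i k) (i k))) U) (Γs : Fin (m + 1) → Contour)
    (hΓs : ∀ k, (Γs k).Surrounds (spectrum ℂ (A (i k) (i k))) U)
    (L : (E (i (Fin.last m)) →L[ℂ] E (i 0)) →L[ℂ] G) :
    multiIntegral (m + 1) Γs
        (fun μ => newtonDifference f m μ • L (resolventProduct A m i μ)) =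
      (2 * Real.pi * Complex.I : ℂ) ^ m •
        L (Γ.integral fun z => f z • resolventProduct A m i fun _ => z) := by
  induction m generalizing f with
  | zero =>
    have hc : ∀ {Γ' : Contour}, Γ'.Surrounds (spectrum ℂ (A (i 0) (i 0))) U →
        ContinuousOn (fun z => f z • resolvent (A (i 0) (i 0)) z) Γ'.trace := fun h =>
      (hf.continuousOn.mono h.trace_subset).smul
        ((differentiableOn_resolvent _).continuousOn.mono h.trace_subset_compl)
    rw [pow_zero, one_smul]
    have h1 : (Γs 0).integral (fun z => f z • resolvent (A (i 0) (i 0)) z) =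
        Γ.integral fun z => f z • resolvent (A (i 0) (i 0)) z := by
      refine Contour.integral_eq_of_windingNumber_eq
        (hU.sdiff (spectrum.isClosed (A (i 0) (i 0)))) ?_ (hΓs 0).1 (hΓ 0).1 fun w hw => ?_
      · exact (hf.mono sdiff_subset).smul
          ((differentiableOn_resolvent (A (i 0) (i 0))).mono fun z hz => hz.2)
      · by_cases hwU : w ∈ U
        · have hwσ : w ∈ spectrum ℂ (A (i 0) (i 0)) := by_contra fun h => hw ⟨hwU, h⟩
          rw [(hΓs 0).2.1 w hwσ, (hΓ 0).2.1 w hwσ]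
        · rw [(hΓs 0).2.2 w hwU, (hΓ 0).2.2 w hwU]
    have h2 := Contour.integral_clm L (hc (hΓs 0))
    rw [h1] at h2
    simp only [map_smul] at h2
    exact h2
  | succ m ih =>
    have hstep : ∀ z ∈ (Γs 0).trace,
        multiIntegral (m + 1) (Fin.tail Γs) (fun μ =>
          newtonDifference f (m + 1) (Fin.cons z μ) •
            L (resolventProduct A (m + 1) i (Fin.cons z μ))) =
        (2 * Real.pi * Complex.I : ℂ) ^ m •
          L (((resolvent (A (i 0) (i 0)) z : E (i 0) →L[ℂ] E (i 0)).comp (A (i 0) (i 1))).comp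
            (Γ.integral fun w => dslope f z w • resolventProduct A m (Fin.tail i) fun _ => w)) := by
      intro z hz
      have h := ih ((Complex.differentiableOn_dslope
        (hU.mem_nhds ((hΓs 0).trace_subset hz))).2 hf) (Fin.tail i) (fun k => hΓ k.succ)
        (Fin.tail Γs) (fun k => hΓs k.succ)
        (L.comp (compL ℂ (E (i (Fin.last (m + 1)))) (E (i 1)) (E (i 0))
          ((resolvent (A (i 0) (i 0)) z : E (i 0) →L[ℂ] E (i 0)).comp (A (i 0) (i 1)))))
      simp only [newtonDifference_succ]
      exact h
    have hsurr : Γ.trace ⊆ (⋃ k, spectrum ℂ (A (i k) (i k)))ᶜ := fun z hz h => by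
      obtain ⟨k, hk⟩ := mem_iUnion.1 h
      exact ((hΓ k).1 hz).2 hk
    have h0 : Γ.integral (fun w => resolventProduct A (m + 1) i fun _ => w) = 0 := by
      refine Contour.integral_eq_zero_of_isBigO
        (isCompact_iUnion fun k => spectrum.isCompact (A (i k) (i k)))
        (differentiableOn_resolventProduct A (m + 1) i) hsurr (fun w hw => ?_)
        (isBigO_resolventProduct_succ A m i (isBigO_resolventProduct A m _))
      obtain ⟨k, hk⟩ := mem_iUnion.1 hw
      exact (hΓ k).2.1 w hk
    have hP : ContinuousOn (fun w => resolventProduct A m (Fin.tail i) fun _ => w) Γ.trace := by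
      refine (differentiableOn_resolventProduct A m (Fin.tail i)).continuousOn.mono
        (hsurr.trans (compl_subset_compl.2 ?_))
      exact iUnion_subset fun k => subset_iUnion (fun k => spectrum ℂ (A (i k) (i k))) k.succ
    have hlast := integral_resolvent_comp_integral_dslope hU hf (A (i 0) (i 1)) (hΓs 0) (hΓ 0).1
      hP h0 L
    rw [multiIntegral, Contour.integral_congr hstep, Contour.integral_smul, pow_succ, mul_smul]
    exact congrArg _ hlast

end ResolventProducts

end CausalCalculus

theorem theoremt {n : ℕ} (E : Fin n → Type*) [∀ i, NormedAddCommGroup (E i)]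
    [∀ i, NormedSpace ℂ (E i)] [∀ i, CompleteSpace (E i)] [∀ i, Nontrivial (E i)]
    (A : lowerTriangular E) (U : Set ℂ) (hU : IsOpen U) (hAU : causalSpectrum A ⊆ U)
    (f : ℂ → ℂ) (hf : AnalyticOnNhd ℂ f U)
    (m : ℕ) (i : Fin (m + 1) → Fin n) (hi : StrictAnti i)
    (Γ : Contour) (hΓ : Contour.Surrounds Γ (causalSpectrum A) U)
    (Γs : Fin (m + 1) → Contour)
    (hΓs : ∀ k, Contour.Surrounds (Γs k) (spectrum ℂ ((A : BlockMatrix E) (i k) (i k))) U) :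
    ContinuousOn
      (fun μ : Fin (m + 1) → ℂ =>
        dividedDifference f m μ • resolventProduct (A : BlockMatrix E) m i μ)
      (Set.univ.pi fun k => Contour.trace (Γs k)) ∧
    operatorDividedDifference Γ f (A : BlockMatrix E) m i =
      ((2 * Real.pi * Complex.I : ℂ) ^ (m + 1))⁻¹ •
        multiIntegral (m + 1) Γs fun μ =>
          dividedDifference f m μ • resolventProduct (A : BlockMatrix E) m i μ := by
  have hd : DifferentiableOn ℂ f U := hf.differentiableOn
  have heq : ∀ μ ∈ Set.univ.pi fun k => Contour.trace (Γs k),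
      dividedDifference f m μ • resolventProduct (A : BlockMatrix E) m i μ =
        newtonDifference f m μ • resolventProduct (A : BlockMatrix E) m i μ := fun μ hμ => by
    rw [dividedDifference_eq_newtonDifference hU hd m fun k =>
      (hΓs k).trace_subset (hμ k (Set.mem_univ _))]
  constructor
  · have hN : ContinuousOn (newtonDifference f m) (Set.univ.pi fun k => Contour.trace (Γs k)) :=
      (continuousOn_newtonDifference hU hd m).mono
        (Set.pi_mono fun k _ => (hΓs k).trace_subset)
    have hP : ContinuousOn (resolventProduct (A : BlockMatrix E) m i)
        (Set.univ.pi fun k => Contour.trace (Γs k)) :=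
      (continuousOn_resolventProduct (A : BlockMatrix E) m i).mono
        (Set.pi_mono fun k _ => (hΓs k).trace_subset_compl)
    exact (hN.smul hP).congr heq
  · have h := multiIntegral_newtonDifference (A : BlockMatrix E) hU Γ m hd i
      (fun k => hΓ.mono (spectrum_diag_subset_causalSpectrum A (i k))) Γs hΓs
      (ContinuousLinearMap.id ℂ _)
    simp only [ContinuousLinearMap.id_apply] at h
    rw [multiIntegral_congr (m + 1) heq, h, smul_smul, operatorDividedDifference]
    congr 1
    have h0 := Complex.two_pi_I_ne_zero
    field_simp
    ring
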